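/- Let $p\ge 2$ and $m\ge 1$ be integers and let $\sigma_0>0$, $\theta_1,\theta_2>1$, $\kappa_A,\kappa_B\ge 0$, $\kappa_C\ge 1$, $L_p\ge 3$, $\kappa_{high}\ge 0$, $\kappa_p$ be real numbers. All vector norms are Euclidean, and $\|T\|=\max_{\|v_1\|=\dots=\|v_p\|=1}|T[v_1,\dots,v_p]|$ for a $p$-linear form $T$ on $\mathbb{R}^n$; $T[s]^i=T[s,\dots,s]$. **Assumptions on $f:\mathbb{R}^n\to\mathbb{R}$.** (1) $f$ is $p$ times continuously differentiable. (2) $f(x)\ge f_{\rm low}$ for all $x$. (3) $\|\nabla^p f(x)-\nabla^p f(y)\|\le L_p\|x-y\|$ for all $x,y$. (4) $\nabla^i f(x)[d]^i\ge-\kappa_{high}$ for all $x$, all $\|d\|\le 1$ and all $3\le i\le p-1$. (5) If $p\ge 3$, then $\|\nabla^p f(x)\|\le\kappa_p$ for all $x$. **Algorithm ARp-approx.** From $x_0\in\mathbb{R}^n$ and $\sigma_0$, the algorithm produces $p$-linear forms $T_k$, steps $s_k$, iterates $x_{k+1}=x_k+s_k$ and parameters $\sigma_{k+1}=\sigma_k+\sigma_k\|s_k\|^{p+1}$,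 $k\ge0$, as follows. With $\overline T_k(s)=f(x_k)+\sum_{i=1}^{p-1}\frac1{i!}\nabla^i f(x_k)[s]^i+\frac1{p!}T_k[s]^p$ and $m_k(s)=\overline T_k(s)+\frac{\sigma_k}{(p+1)!}\|s\|^{p+1}$, the step $s_k$ is any vector with $$m_k(s_k)\le m_k(0),\qquad \|\nabla\overline T_k(s_k)\|\le\frac{\theta_1\sigma_k\|s_k\|^p}{p!},\qquad \max[0,-\lambda_{\min}(\nabla^2\overline T_k(s_k))]\le\frac{\theta_2\sigma_k\|s_k\|^{p-1}}{(p-1)!}.$$ The tensors $T_k$ are arbitrary subject to the following condition, in which $\|s_j\|:=1$ for $j<0$ and $\widetilde T_k=\int_0^1\nabla^pf(x_k+ts_k)\,dt$: if $k\bmod m=0$, then $\|T_k-\nabla^pf(x_k)\|\le\min\bigl(\kappa_A\sum_{i=1}^m\|s_{k-i}\|,\ \kappa_B\bigr)$; otherwise $\|T_k-\widetilde T_{k-1}\|\le\kappa_C\|T_{k-1}-\widetilde T_{k-1}\|$. **Theorem.** For all real $\Delta_0,G_0,B_0$ there is a constant $C>0$, depending only on $p,m,\sigma_0,\theta_1,\theta_2,\kappa_A,\kappa_B,\kappa_C,L_p,\kappa_{high},\kappa_p,\Delta_0,G_0,B_0$,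 such that for every $n$, every $f$ satisfying (1)–(5) and every sequence of iterates $(x_k)$ produced by ARp-approx with $f(x_0)-f_{\rm low}\le\Delta_0$, $\|\nabla f(x_0)\|\le G_0$ and $\max[0,-\lambda_{\min}(\nabla^2 f(x_0))]\le B_0$, the following hold. 1. $\displaystyle\min_{1\le j\le k+1}\|\nabla f(x_j)\|\le C\,(k+1)^{-p/(p+1)}$ for all $k\ge0$. 2. $\displaystyle\min_{1\le j\le k+1}\max[0,-\lambda_{\min}(\nabla^2f(x_j))]\le C\,(k+1)^{-(p-1)/(p+1)}$ for all $k\ge0$. 3. For all $\varepsilon_1,\varepsilon_2>0$ there is an index $j\le C\max[\varepsilon_1^{-(p+1)/p},\varepsilon_2^{-(p+1)/(p-1)}]$ with $\|\nabla f(x_j)\|\le\varepsilon_1$ and $\lambda_{\min}(\nabla^2f(x_j))\ge-\varepsilon_2$. -/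

import Mathlib

open scoped Gradient

noncomputable section

namespace ARpApprox

variable {n : ℕ}

/-- `ℝⁿ` with the Euclidean norm. -/
abbrev Vec (n : ℕ) : Type := EuclideanSpace ℝ (Fin n)

/-- Tensors of order `p`: `p`-linear forms on `ℝⁿ`, with the norm
`‖T‖ = max_{‖s₁‖ = ⋯ = ‖s_p‖ = 1} |T[s₁, …, s_p]|` (not necessarily symmetric). -/
abbrev Tensor (n p : ℕ) : Type := ContinuousMultilinearMap ℝ (fun _ : Fin p => Vec n) ℝ

/-- The Hessian of `F` at `x`, as an operator on `ℝⁿ`. -/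
def hessian (F : Vec n → ℝ) (x : Vec n) : Vec n →L[ℝ] Vec n :=
  fderiv ℝ (∇ F) x

/-- The leftmost eigenvalue of an operator on `ℝⁿ`. (It is only applied to Hessians of `C²`
functions, which are self-adjoint and so have a smallest eigenvalue when `n ≥ 1`.) -/
def lambdaMin (A : Vec n →L[ℝ] Vec n) : ℝ :=
  sInf {μ : ℝ | Module.End.HasEigenvalue (A : Vec n →ₗ[ℝ] Vec n) μ}

/-- The negative curvature `max[0, -λ_min(∇²F(x))]`. -/
def negCurv (F : Vec n → ℝ) (x : Vec n) : ℝ :=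
  max 0 (-lambdaMin (hessian F x))

/-- `x` is an `(ε₁, ε₂)` second-order approximate stationary point of `f`. -/
def IsSecondOrderStationary (f : Vec n → ℝ) (ε₁ ε₂ : ℝ) (x : Vec n) : Prop :=
  ‖∇ f x‖ ≤ ε₁ ∧ -ε₂ ≤ lambdaMin (hessian f x)

/-- The assumptions on the objective function `f : ℝⁿ → ℝ`. -/
structure ObjectiveAssumptions (p : ℕ) (L κhigh κp flow : ℝ) (f : Vec n → ℝ) : Prop where
  contDiff : ContDiff ℝ p f
  lower_bound : ∀ x, flow ≤ f x
  lipschitz : ∀ x y, ‖iteratedFDeriv ℝ p f x - iteratedFDeriv ℝ p f y‖ ≤ L * ‖x - y‖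
  intermediate : ∀ i ∈ Finset.Icc 3 (p - 1), ∀ x d : Vec n, ‖d‖ ≤ 1 →
    -κhigh ≤ iteratedFDeriv ℝ i f x (fun _ => d)
  bounded : 3 ≤ p → ∀ x, ‖iteratedFDeriv ℝ p f x‖ ≤ κp

/-- The `p`th-order Taylor expansion of `f` at `x` as a function of the step `s`, with the exact
derivatives up to order `p - 1` and with `T` in place of the `p`th derivative. -/
def approxTaylor (p : ℕ) (f : Vec n → ℝ) (x : Vec n) (T : Tensor n p) (s : Vec n) : ℝ :=
  f x + ∑ i ∈ Finset.Icc 1 (p - 1), (1 / (i.factorial : ℝ)) * iteratedFDeriv ℝ i f x (fun _ => s)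
    + (1 / (p.factorial : ℝ)) * T (fun _ => s)

/-- The regularized model. -/
def model (p : ℕ) (f : Vec n → ℝ) (x : Vec n) (T : Tensor n p) (σ : ℝ) (s : Vec n) : ℝ :=
  approxTaylor p f x T s + σ / ((p + 1).factorial : ℝ) * ‖s‖ ^ (p + 1)

/-- The step length `‖s_j‖`, with the convention that it is `1` for negative `j`. -/
def stepLength (s : ℕ → Vec n) (j : ℤ) : ℝ :=
  if 0 ≤ j then ‖s j.toNat‖ else 1

/-- The average of the `p`th derivative over the segment from `x` to `x + s`. -/
def averagedTensor (p : ℕ) (f : Vec n → ℝ) (x s : Vec n) : Tensor n p :=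
  ∫ t in (0 : ℝ)..1, iteratedFDeriv ℝ p f (x + t • s)

/-- The condition on the tensor approximations `T_k` along the iterates `x_k` and steps `s_k`. -/
structure TensorCondition (p m : ℕ) (κA κB κC : ℝ) (f : Vec n → ℝ)
    (x s : ℕ → Vec n) (T : ℕ → Tensor n p) : Prop where
  restart : ∀ k : ℕ, k % m = 0 →
    ‖T k - iteratedFDeriv ℝ p f (x k)‖ ≤
      min (κA * ∑ i ∈ Finset.Icc 1 m, stepLength s ((k : ℤ) - (i : ℤ))) κB
  update : ∀ k : ℕ, (k + 1) % m ≠ 0 →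
    ‖T (k + 1) - averagedTensor p f (x k) (s k)‖ ≤
      κC * ‖T k - averagedTensor p f (x k) (s k)‖

/-- `x`, `s`, `σ`, `T` are the iterates, steps, regularization parameters and tensor approximations
of a run of the algorithm, started with the regularization parameter `σ₀`. The subroutine that
produces `T_k` is arbitrary, subject to `TensorCondition`. -/
structure IsRun (p m : ℕ) (σ₀ θ₁ θ₂ κA κB κC : ℝ) (f : Vec n → ℝ)
    (x s : ℕ → Vec n) (σ : ℕ → ℝ) (T : ℕ → Tensor n p) : Prop where
  tensor : TensorCondition p m κA κB κC f x s T
  model_decrease : ∀ k, model p f (x k) (T k) (σ k) (s k) - model p f (x k) (T k) (σ k) 0 ≤ 0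
  first_order : ∀ k, ‖∇ (approxTaylor p f (x k) (T k)) (s k)‖ ≤
    θ₁ * σ k * ‖s k‖ ^ p / (p.factorial : ℝ)
  second_order : ∀ k, negCurv (approxTaylor p f (x k) (T k)) (s k) ≤
    θ₂ * σ k * ‖s k‖ ^ (p - 1) / ((p - 1).factorial : ℝ)
  iterate : ∀ k, x (k + 1) = x k + s k
  sigma_zero : σ 0 = σ₀
  sigma_succ : ∀ k, σ (k + 1) = σ k + σ k * ‖s k‖ ^ (p + 1)

end ARpApprox

end

/-! Write r_k = ‖s_k‖ and let V_k be the sum of the previous 2m step lengths (length 1 for negative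
indices). The averaged tensor lies within L r_k of the pth derivative at both ends of the step, so
an update multiplies the tensor error by at most κC and adds a multiple of r_k. A cycle has length m
and restarts with an error controlled by m earlier steps, hence ‖T_k - ∇^p f(x_k)‖ ≤ E V_k
(`TensorCondition.error_le`).

Inserting this in the Taylor remainder (`norm_iteratedFDeriv_sub_iteratedFDeriv_approxTaylor_le`),
one step decreases f by σ_k r_k^(p+1)/(p+1)! up to K (r_k + V_k)^(p+1). The new gradient and
negative curvature are at most K (1 + σ_k) times (r_k + V_k)^p and (r_k + V_k)^(p-1). From here on
only the scalar inequalities of `StepRecurrence` are used.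

The crux is a uniform bound on σ (`exists_sigma_bound`). Each step occurs in boundedly many windows,
so Σ (r_j + V_j)^(p+1) ≤ M (1 + Σ r_j^(p+1)), and telescoping f gives Σ (σ_j - A) r_j^(p+1) ≤ const
with A = (p+1)! K M. Once σ_j exceeds 2A this sum controls half of the growth Σ σ_j r_j^(p+1) of σ.
The one step that crosses the threshold could still be long. It is bounded because model decrease
limits long steps through the current gradient, curvature and window, which the earlier steps
control (`exists_step_bound`).

With σ ≤ S, the sum of r_j^(p+1) is at most S/σ₀, so among k + 1 steps some (r_j + V_j)^(p+1) is
O(1/(k+1)). That single index gives both rates (`exists_rate`), and the simultaneity yields the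
complexity bound (`exists_index_of_rates`). -/

noncomputable section

namespace ARpApprox

/-! ### Symmetry of iterated derivatives -/

section Symmetry

universe u

variable {E : Type u} [NormedAddCommGroup E] [NormedSpace ℝ E]

/-- The iterated derivative of a `C^(k+1)` function is invariant under adjacent transpositions. -/
theorem iteratedFDeriv_comp_swap (k : ℕ) :
    ∀ {F : Type u} [NormedAddCommGroup F] [NormedSpace ℝ F] {f : E → F},
      ContDiff ℝ (k + 1 : ℕ) f → ∀ (i : Fin k) (x : E) (v : Fin (k + 1) → E),
      iteratedFDeriv ℝ (k + 1) f x (v ∘ Equiv.swap i.castSucc i.succ) =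
        iteratedFDeriv ℝ (k + 1) f x v := by
  induction k with
  | zero => intro F _ _ f _ i; exact i.elim0
  | succ k ih =>
    intro F _ _ f hf i x v
    have hd : DifferentiableAt ℝ (iteratedFDeriv ℝ (k + 1) f) x :=
      (hf.differentiable_iteratedFDeriv (by norm_cast; omega)) x
    -- The swap of the first two slots fixes the last one when there are at least three, so it acts
    -- on derivatives of `fderiv ℝ f`; this is why `F` varies in the induction. Any other swap fixes
    -- the first slot and acts on the derivative of order `k + 1` of `f` itself.
    rcases Fin.eq_zero_or_eq_succ i with rfl | ⟨j, rfl⟩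
    · cases k with
      | zero =>
        have hs : IsSymmSndFDerivAt ℝ f x :=
          hf.contDiffAt.isSymmSndFDerivAt (by simp)
        rw [iteratedFDeriv_two_apply, iteratedFDeriv_two_apply]
        simpa using hs (v 1) (v 0)
      | succ k =>
        have hf' : ContDiff ℝ (k + 1 + 1 - 1 + 1 : ℕ) (fun y => fderiv ℝ f y) :=
          hf.fderiv_right (by norm_cast)
        have h := ih hf' 0 x (Fin.init v)
        have h1 : Fin.init (v ∘ Equiv.swap (0 : Fin (k + 1 + 1)).castSucc
            (0 : Fin (k + 1 + 1)).succ) =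
            Fin.init v ∘ Equiv.swap (0 : Fin (k + 1)).castSucc (0 : Fin (k + 1)).succ := by
          funext a
          simp only [Fin.init, Function.comp]
          congr 1
          rw [← Fin.coe_castSuccEmb, ← Fin.coe_castSuccEmb,
            ← Function.Embedding.swap_apply]
          rfl
        have h2 : (v ∘ Equiv.swap (0 : Fin (k + 1 + 1)).castSucc
            (0 : Fin (k + 1 + 1)).succ) (Fin.last (k + 1 + 1)) = v (Fin.last (k + 1 + 1)) := by
          simp only [Function.comp]
          rw [Equiv.swap_apply_of_ne_of_ne]
          · simp [Fin.ext_iff]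
          · simp [Fin.ext_iff]
        rw [iteratedFDeriv_succ_apply_right (v ∘ _), h1, h2, h,
          ← iteratedFDeriv_succ_apply_right]
    · rw [hd.iteratedFDeriv_succ_apply_left', hd.iteratedFDeriv_succ_apply_left']
      have hf' : ContDiff ℝ (k + 1 : ℕ) f := hf.of_le (by norm_cast; omega)
      have h1 : Fin.tail (v ∘ Equiv.swap j.succ.castSucc j.succ.succ) =
          Fin.tail v ∘ Equiv.swap j.castSucc j.succ := by
        funext a
        simp only [Fin.tail, Function.comp]
        congr 1
        rw [← Fin.succ_castSucc, ← Fin.coe_succEmb, ← Fin.coe_succEmb,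
          Function.Embedding.swap_apply]
      have h2 : (v ∘ Equiv.swap j.succ.castSucc j.succ.succ) 0 = v 0 := by
        simp only [Function.comp]
        rw [Equiv.swap_apply_of_ne_of_ne]
        · simp [Fin.ext_iff]
        · simp [Fin.ext_iff]
      rw [h1, h2]
      simp only [ih hf']

/-- The iterated derivative of order `k` of a `C^k` function is symmetric. -/
theorem iteratedFDeriv_comp_perm_of_contDiff {F : Type u} [NormedAddCommGroup F] [NormedSpace ℝ F]
    {f : E → F} {k : ℕ} (hf : ContDiff ℝ k f) (x : E) (v : Fin k → E) (τ : Equiv.Perm (Fin k)) :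
    iteratedFDeriv ℝ k f x (fun i => v (τ i)) = iteratedFDeriv ℝ k f x v := by
  cases k with
  | zero => congr 1; funext a; exact a.elim0
  | succ k =>
    have hτ : τ ∈ Submonoid.closure (Set.range fun i : Fin k => Equiv.swap i.castSucc i.succ) := by
      rw [Equiv.Perm.mclosure_swap_castSucc_succ]; trivial
    induction hτ using Submonoid.closure_induction generalizing v with
    | mem τ h =>
      obtain ⟨i, rfl⟩ := h
      exact iteratedFDeriv_comp_swap k hf i x v
    | one => rfl
    | mul a b _ _ ha hb =>
      have := hb (fun i => v (a i))
      simp only [Equiv.Perm.mul_apply]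
      rw [this, ha]

end Symmetry

/-! ### Derivatives of polynomials -/

section Polynomial

variable {E F : Type*} [NormedAddCommGroup E] [NormedSpace ℝ E] [NormedAddCommGroup F]
  [NormedSpace ℝ F]

/-- Each differentiation shortens the finite power series by one term. -/
theorem exists_hasFiniteFPowerSeriesOnBall_iteratedFDeriv {f : E → F}
    {q : FormalMultilinearSeries ℝ E F} {x : E} {d : ℕ} {r : ENNReal} (k : ℕ)
    (h : HasFiniteFPowerSeriesOnBall f q x (d + k) r) :
    ∃ q' : FormalMultilinearSeries ℝ E (E [×k]→L[ℝ] F),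
      HasFiniteFPowerSeriesOnBall (iteratedFDeriv ℝ k f) q' x d r := by
  induction k generalizing d with
  | zero =>
    rw [iteratedFDeriv_zero_eq_comp]
    exact ⟨_, ((continuousMultilinearCurryFin0 ℝ E F).symm
      |>.toContinuousLinearEquiv.toContinuousLinearMap.comp_hasFiniteFPowerSeriesOnBall h)⟩
  | succ k ih =>
    obtain ⟨q', hq'⟩ := ih (d := d + 1) (by convert h using 1; omega)
    rw [iteratedFDeriv_succ_eq_comp_left]
    exact ⟨_, ((continuousMultilinearCurryLeftEquiv ℝ (fun _ : Fin (k + 1) => E) F).symm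
      |>.toContinuousLinearEquiv.toContinuousLinearMap.comp_hasFiniteFPowerSeriesOnBall
        hq'.fderiv)⟩

/-- The derivative of order `d` of a polynomial of degree at most `d` is constant. -/
theorem iteratedFDeriv_eq_const_of_hasFiniteFPowerSeriesOnBall {f : E → F}
    {q : FormalMultilinearSeries ℝ E F} {x : E} {d : ℕ}
    (h : HasFiniteFPowerSeriesOnBall f q x (d + 1) ⊤) (y : E) :
    iteratedFDeriv ℝ d f y = iteratedFDeriv ℝ d f x := by
  obtain ⟨q', hq'⟩ := exists_hasFiniteFPowerSeriesOnBall_iteratedFDeriv (d := 1) d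
    (by convert h using 1; omega)
  exact hq'.eq_const_of_bound_one y (by simp)

/-- A function whose derivatives of order below `p` vanish at the origin and whose derivative of
order `p` is bounded on a ball has small derivatives of order `i ≤ p`. -/
theorem norm_iteratedFDeriv_le_of_iteratedFDeriv_zero {h : E → F} {p : ℕ} (hh : ContDiff ℝ p h)
    (h0 : ∀ i < p, iteratedFDeriv ℝ i h 0 = 0) {r M : ℝ}
    (hM : ∀ s, ‖s‖ ≤ r → ‖iteratedFDeriv ℝ p h s‖ ≤ M) (j : ℕ) (hj : j ≤ p) (s : E)
    (hs : ‖s‖ ≤ r) :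
    ‖iteratedFDeriv ℝ (p - j) h s‖ ≤ M * r ^ j := by
  induction j generalizing s with
  | zero => simpa using hM s hs
  | succ j ih =>
    have hr : 0 ≤ r := (norm_nonneg _).trans hs
    have hlt : p - (j + 1) < p := by omega
    have hsucc : p - (j + 1) + 1 = p - j := by omega
    have hdiff : Differentiable ℝ (iteratedFDeriv ℝ (p - (j + 1)) h) :=
      hh.differentiable_iteratedFDeriv (by exact_mod_cast hlt)
    -- Downward induction from order `p`: the mean value inequality from the origin, where this
    -- derivative vanishes, gains one factor `r`.
    have key := (convex_closedBall (0 : E) r).norm_image_sub_le_of_norm_fderiv_le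
      (f := iteratedFDeriv ℝ (p - (j + 1)) h) (C := M * r ^ j) (x := 0) (y := s)
      (fun y _ => hdiff y)
      (fun y hy => by
        rw [norm_fderiv_iteratedFDeriv, hsucc]
        exact ih (by omega) y (by simpa using hy))
      (by simpa using hr) (by simpa using hs)
    rw [h0 _ hlt, sub_zero, sub_zero] at key
    have hM0 : 0 ≤ M := (norm_nonneg _).trans (hM s hs)
    calc _ ≤ M * r ^ j * ‖s‖ := key
      _ ≤ M * r ^ j * r := by gcongr
      _ = M * r ^ (j + 1) := by ring

end Polynomial

/-! ### Derivatives of the approximate Taylor expansion -/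

section Taylor

variable {n : ℕ}

/-- The coefficients of `approxTaylor`, as a formal power series. -/
def approxTaylorSeries (p : ℕ) (f : Vec n → ℝ) (x : Vec n) (T : Tensor n p) :
    FormalMultilinearSeries ℝ (Vec n) ℝ := fun i =>
  if i < p then (1 / (i.factorial : ℝ)) • iteratedFDeriv ℝ i f x
  else if h : p = i then h ▸ ((1 / (p.factorial : ℝ)) • T) else 0

theorem approxTaylorSeries_of_lt {p i : ℕ} (f : Vec n → ℝ) (x : Vec n) (T : Tensor n p)
    (hi : i < p) :
    approxTaylorSeries p f x T i = (1 / (i.factorial : ℝ)) • iteratedFDeriv ℝ i f x := by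
  simp [approxTaylorSeries, hi]

theorem approxTaylorSeries_self (p : ℕ) (f : Vec n → ℝ) (x : Vec n) (T : Tensor n p) :
    approxTaylorSeries p f x T p = (1 / (p.factorial : ℝ)) • T := by
  simp [approxTaylorSeries]

theorem hasFiniteFPowerSeriesOnBall_approxTaylor {p : ℕ} (hp : 0 < p) (f : Vec n → ℝ)
    (x : Vec n) (T : Tensor n p) :
    HasFiniteFPowerSeriesOnBall (approxTaylor p f x T) (approxTaylorSeries p f x T) 0 (p + 1) ⊤ := by
  refine HasFiniteFPowerSeriesOnBall.mk' (fun i hi => ?_) (by simp) (fun y _ => ?_)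
  · have h1 : ¬ i < p := by omega
    have h2 : p ≠ i := by omega
    simp [approxTaylorSeries, h1, h2]
  · rw [Finset.sum_range_succ, approxTaylorSeries_self, Finset.range_eq_Ico,
      Finset.sum_eq_sum_Ico_succ_bot hp, approxTaylorSeries_of_lt f x T hp]
    have hI : Finset.Ico (0 + 1) p = Finset.Icc 1 (p - 1) := by ext i; simp; omega
    rw [hI, zero_add, approxTaylor]
    congr 1
    congr 1
    · simp
    · refine Finset.sum_congr rfl fun i hi => ?_
      rw [approxTaylorSeries_of_lt f x T (by simp at hi; omega)]
      rfl

theorem contDiff_approxTaylor {p : ℕ} (hp : 0 < p) (f : Vec n → ℝ) (x : Vec n) (T : Tensor n p)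
    {k : WithTop ℕ∞} : ContDiff ℝ k (approxTaylor p f x T) := by
  rw [← contDiffOn_univ]
  have := (hasFiniteFPowerSeriesOnBall_approxTaylor hp f x T).cpolynomialOn.contDiffOn (n := k)
  simpa using this

/-- Differentiating the `i`th coefficient sums it over all permutations of its arguments. The
derivatives of `f` are symmetric, so the `i!` equal terms cancel the factor `1 / i!`. -/
theorem iteratedFDeriv_approxTaylor_zero {p i : ℕ} {f : Vec n → ℝ} (hf : ContDiff ℝ p f)
    (x : Vec n) (T : Tensor n p) (hi : i < p) :
    iteratedFDeriv ℝ i (approxTaylor p f x T) 0 = iteratedFDeriv ℝ i f x := by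
  ext v
  rw [(hasFiniteFPowerSeriesOnBall_approxTaylor (by omega) f x
    T).toHasFPowerSeriesOnBall.iteratedFDeriv_eq_sum_of_completeSpace v,
    approxTaylorSeries_of_lt f x T hi]
  have hi' : ContDiff ℝ i f := hf.of_le (by exact_mod_cast hi.le)
  simp only [smul_apply, iteratedFDeriv_comp_perm_of_contDiff hi']
  rw [Finset.sum_const, Finset.card_univ, Fintype.card_perm, Fintype.card_fin]
  have : (i.factorial : ℝ) ≠ 0 := by positivity
  simp [this]

/-- `T` need not be symmetric, so the derivative of order `p` at the origin is the symmetrization of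
`T`. Symmetrizing fixes the symmetric tensor `iteratedFDeriv ℝ p f x` and does not increase norms.
-/
theorem norm_iteratedFDeriv_sub_approxTaylor_zero_le {p : ℕ} (hp : 0 < p) {f : Vec n → ℝ}
    (hf : ContDiff ℝ p f) (x : Vec n) (T : Tensor n p) :
    ‖iteratedFDeriv ℝ p f x - iteratedFDeriv ℝ p (approxTaylor p f x T) 0‖ ≤
      ‖T - iteratedFDeriv ℝ p f x‖ := by
  refine ContinuousMultilinearMap.opNorm_le_bound (norm_nonneg _) fun v => ?_
  have hfac : (0 : ℝ) < p.factorial := by positivity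
  have hsum : ∑ τ : Equiv.Perm (Fin p), iteratedFDeriv ℝ p f x (fun i => v (τ i)) =
      p.factorial * iteratedFDeriv ℝ p f x v := by
    simp only [iteratedFDeriv_comp_perm_of_contDiff hf]
    rw [Finset.sum_const, Finset.card_univ, Fintype.card_perm, Fintype.card_fin, nsmul_eq_mul]
  have hdiff : (iteratedFDeriv ℝ p f x - iteratedFDeriv ℝ p (approxTaylor p f x T) 0) v =
      -((1 / (p.factorial : ℝ)) * ∑ τ : Equiv.Perm (Fin p),
        (T - iteratedFDeriv ℝ p f x) (fun i => v (τ i))) := by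
    simp only [sub_apply, Finset.sum_sub_distrib, hsum]
    rw [(hasFiniteFPowerSeriesOnBall_approxTaylor hp f x
      T).toHasFPowerSeriesOnBall.iteratedFDeriv_eq_sum_of_completeSpace v,
      approxTaylorSeries_self]
    simp only [smul_apply, smul_eq_mul, ← Finset.mul_sum]
    field_simp
    ring
  rw [hdiff, norm_neg, norm_mul, Real.norm_of_nonneg (by positivity : (0 : ℝ) ≤ 1 / p.factorial)]
  have hle : ‖∑ τ : Equiv.Perm (Fin p), (T - iteratedFDeriv ℝ p f x) (fun i => v (τ i))‖ ≤
      p.factorial * (‖T - iteratedFDeriv ℝ p f x‖ * ∏ i, ‖v i‖) := by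
    refine (norm_sum_le _ _).trans ?_
    have : ∀ τ ∈ (Finset.univ : Finset (Equiv.Perm (Fin p))),
        ‖(T - iteratedFDeriv ℝ p f x) (fun i => v (τ i))‖ ≤
          ‖T - iteratedFDeriv ℝ p f x‖ * ∏ i, ‖v i‖ := fun τ _ => by
      refine ((T - iteratedFDeriv ℝ p f x).le_opNorm _).trans_eq ?_
      rw [Equiv.prod_comp τ fun i => ‖v i‖]
    refine (Finset.sum_le_sum this).trans_eq ?_
    rw [Finset.sum_const, Finset.card_univ, Fintype.card_perm, Fintype.card_fin, nsmul_eq_mul]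
  calc _ ≤ 1 / (p.factorial : ℝ) * (p.factorial * (‖T - iteratedFDeriv ℝ p f x‖ * ∏ i, ‖v i‖)) := by
        gcongr
    _ = _ := by field_simp

/-- The derivatives of the approximate Taylor expansion approximate those of the function. -/
theorem norm_iteratedFDeriv_sub_iteratedFDeriv_approxTaylor_le {p : ℕ} (hp : 0 < p)
    {f : Vec n → ℝ} (hf : ContDiff ℝ p f) {L : ℝ} (hL : 0 ≤ L)
    (hlip : ∀ x y, ‖iteratedFDeriv ℝ p f x - iteratedFDeriv ℝ p f y‖ ≤ L * ‖x - y‖)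
    (x s : Vec n) (T : Tensor n p) {i : ℕ} (hi : i ≤ p) :
    ‖iteratedFDeriv ℝ i f (x + s) - iteratedFDeriv ℝ i (approxTaylor p f x T) s‖ ≤
      (L * ‖s‖ + ‖T - iteratedFDeriv ℝ p f x‖) * ‖s‖ ^ (p - i) := by
  have hshift : ContDiff ℝ p (fun y => f (x + y)) := hf.comp (contDiff_const.add contDiff_id)
  have hP : ContDiff ℝ p (approxTaylor p f x T) := contDiff_approxTaylor hp f x T
  have hder : ∀ j ≤ p, ∀ y, iteratedFDeriv ℝ j (fun y => f (x + y) - approxTaylor p f x T y) y =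
      iteratedFDeriv ℝ j f (x + y) - iteratedFDeriv ℝ j (approxTaylor p f x T) y := by
    intro j hj y
    have hj' : ((j : ℕ) : WithTop ℕ∞) ≤ p := by exact_mod_cast hj
    have := iteratedFDeriv_sub_apply (x := y) (hshift.of_le hj').contDiffAt
      (hP.of_le hj').contDiffAt
    rw [iteratedFDeriv_comp_add_left] at this
    exact this
  have key := norm_iteratedFDeriv_le_of_iteratedFDeriv_zero (r := ‖s‖)
    (M := L * ‖s‖ + ‖T - iteratedFDeriv ℝ p f x‖) (hshift.sub hP)
    (fun j hj => by
      rw [hder j hj.le, iteratedFDeriv_approxTaylor_zero hf x T hj, add_zero, sub_self])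
    (fun y hy => by
      -- The approximate Taylor expansion has degree at most `p`, so its derivative of order `p` may
      -- be evaluated at the origin.
      rw [hder p le_rfl, iteratedFDeriv_eq_const_of_hasFiniteFPowerSeriesOnBall
        (hasFiniteFPowerSeriesOnBall_approxTaylor hp f x T) y]
      have h1 := hlip (x + y) x
      rw [add_sub_cancel_left] at h1
      calc _ = ‖(iteratedFDeriv ℝ p f (x + y) - iteratedFDeriv ℝ p f x) +
            (iteratedFDeriv ℝ p f x - iteratedFDeriv ℝ p (approxTaylor p f x T) 0)‖ := by
              rw [sub_add_sub_cancel]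
        _ ≤ L * ‖y‖ + ‖T - iteratedFDeriv ℝ p f x‖ :=
            (norm_add_le _ _).trans
              (add_le_add h1 (norm_iteratedFDeriv_sub_approxTaylor_zero_le hp hf x T))
        _ ≤ _ := by gcongr)
    (p - i) (by omega) s le_rfl
  rw [show p - (p - i) = i by omega, hder i hi] at key
  exact key

end Taylor

/-! ### The Hessian and its leftmost eigenvalue -/

section Hessian

variable {n : ℕ}

theorem inner_hessian {F : Vec n → ℝ} (hF : ContDiff ℝ 2 F) (x u v : Vec n) :
    inner ℝ (hessian F x u) v = iteratedFDeriv ℝ 2 F x ![u, v] := by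
  have hd : DifferentiableAt ℝ (fderiv ℝ F) x :=
    (hF.fderiv_right (m := 1) (by norm_num)).differentiable (by norm_num) x
  let D : StrongDual ℝ (Vec n) →L[ℝ] Vec n :=
    { toFun := (InnerProductSpace.toDual ℝ (Vec n)).symm
      map_add' := map_add _
      map_smul' := fun c y => by simp
      cont := (InnerProductSpace.toDual ℝ (Vec n)).symm.continuous }
  have h : hessian F x = D.comp (fderiv ℝ (fderiv ℝ F) x) :=
    (D.hasFDerivAt.comp x hd.hasFDerivAt).fderiv
  rw [h, iteratedFDeriv_two_apply]
  exact InnerProductSpace.toDual_symm_apply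

theorem negCurv_le {F : Vec n → ℝ} (hF : ContDiff ℝ 2 F) {x : Vec n} {c : ℝ} (hc : 0 ≤ c)
    (h : ∀ v : Vec n, -(c * ‖v‖ ^ 2) ≤ iteratedFDeriv ℝ 2 F x (fun _ => v)) :
    negCurv F x ≤ c := by
  refine max_le hc (neg_le.mp ?_)
  rw [lambdaMin]
  rcases Set.eq_empty_or_nonempty
    {μ : ℝ | Module.End.HasEigenvalue (hessian F x : Vec n →ₗ[ℝ] Vec n) μ} with he | hne
  -- Without eigenvalues `lambdaMin` has the default value 0, and `hc` suffices.
  · rw [he, Real.sInf_empty]; linarith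
  · refine le_csInf hne fun μ hμ => ?_
    obtain ⟨v, hv⟩ := hμ.exists_hasEigenvector
    have hv1 : hessian F x v = μ • v := hv.apply_eq_smul
    have h2 : inner ℝ (hessian F x v) v = iteratedFDeriv ℝ 2 F x (fun _ => v) := by
      rw [inner_hessian hF]
      congr 1; funext i; fin_cases i <;> rfl
    have h3 := h v
    rw [← h2, hv1, real_inner_smul_left, real_inner_self_eq_norm_sq] at h3
    have hpos : 0 < ‖v‖ ^ 2 := by have := norm_pos_iff.mpr hv.2; positivity
    nlinarith

/-- The infimum of the Rayleigh quotient of a symmetric operator on a nontrivial finite-dimensional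
space is an eigenvalue, so `lambdaMin` lies below every Rayleigh quotient. -/
theorem neg_negCurv_mul_le {F : Vec n → ℝ} (hF : ContDiff ℝ 2 F) (x v : Vec n) :
    -(negCurv F x * ‖v‖ ^ 2) ≤ iteratedFDeriv ℝ 2 F x (fun _ => v) := by
  have hsymm : (hessian F x : Vec n →ₗ[ℝ] Vec n).IsSymmetric := by
    intro u w
    change inner ℝ (hessian F x u) w = inner ℝ u (hessian F x w)
    rw [real_inner_comm (hessian F x w) u, inner_hessian hF, inner_hessian hF,
      iteratedFDeriv_two_apply, iteratedFDeriv_two_apply]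
    exact (hF.contDiffAt.isSymmSndFDerivAt (by simp)) u w
  have h2 : inner ℝ (hessian F x v) v = iteratedFDeriv ℝ 2 F x (fun _ => v) := by
    rw [inner_hessian hF]
    congr 1; funext i; fin_cases i <;> rfl
  rw [← h2]
  rcases eq_or_ne v 0 with rfl | hv
  · simp
  have : Nontrivial (Vec n) := ⟨v, 0, hv⟩
  have heig := hsymm.hasEigenvalue_iInf_of_finiteDimensional
  have hfin : Set.Finite
      {μ : ℝ | Module.End.HasEigenvalue (hessian F x : Vec n →ₗ[ℝ] Vec n) μ} :=
    Module.End.finite_hasEigenvalue _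
  have h3 := csInf_le hfin.bddBelow heig
  have hpos : 0 < ‖v‖ ^ 2 := by have := norm_pos_iff.mpr hv; positivity
  have hbdd : BddBelow (Set.range fun y : {y : Vec n // y ≠ 0} =>
      inner ℝ (hessian F x y) (y : Vec n) / ‖(y : Vec n)‖ ^ 2) := by
    refine ⟨-‖hessian F x‖, ?_⟩
    rintro _ ⟨y, rfl⟩
    have hy : 0 < ‖(y : Vec n)‖ ^ 2 := by have := norm_pos_iff.mpr y.2; positivity
    rw [le_div_iff₀ hy]
    have h4 := abs_real_inner_le_norm (hessian F x y) (y : Vec n)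
    have h5 := (hessian F x).le_opNorm (y : Vec n)
    have h6 := neg_le_of_abs_le h4
    nlinarith [norm_nonneg (y : Vec n)]
  have h7 := ciInf_le hbdd ⟨v, hv⟩
  have h8 : lambdaMin (hessian F x) ≤ inner ℝ (hessian F x v) v / ‖v‖ ^ 2 := h3.trans h7
  rw [le_div_iff₀ hpos] at h8
  have h9 : -lambdaMin (hessian F x) ≤ negCurv F x := le_max_right _ _
  nlinarith

theorem negCurv_nonneg (F : Vec n → ℝ) (x : Vec n) : 0 ≤ negCurv F x := le_max_left _ _

theorem norm_gradient_sub_le (F G : Vec n → ℝ) (x y : Vec n) :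
    ‖∇ F x - ∇ G y‖ ≤ ‖iteratedFDeriv ℝ 1 F x - iteratedFDeriv ℝ 1 G y‖ := by
  rw [gradient, gradient, ← map_sub, LinearIsometryEquiv.norm_map]
  refine ContinuousLinearMap.opNorm_le_bound _ (norm_nonneg _) fun v => ?_
  have h := (iteratedFDeriv ℝ 1 F x - iteratedFDeriv ℝ 1 G y).le_opNorm fun _ => v
  simpa [iteratedFDeriv_one_apply] using h

end Hessian

/-! ### The averaged tensor -/

section Averaged

variable {n : ℕ}

theorem norm_averagedTensor_sub_le {p : ℕ} {f : Vec n → ℝ} (hf : ContDiff ℝ p f) {M : ℝ}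
    (x s y : Vec n)
    (hM : ∀ t ∈ Set.Icc (0 : ℝ) 1,
      ‖iteratedFDeriv ℝ p f (x + t • s) - iteratedFDeriv ℝ p f y‖ ≤ M) :
    ‖averagedTensor p f x s - iteratedFDeriv ℝ p f y‖ ≤ M := by
  have hcont : Continuous fun t : ℝ => iteratedFDeriv ℝ p f (x + t • s) :=
    (hf.continuous_iteratedFDeriv le_rfl).comp (by fun_prop)
  have h : averagedTensor p f x s - iteratedFDeriv ℝ p f y =
      ∫ t in (0 : ℝ)..1, (iteratedFDeriv ℝ p f (x + t • s) - iteratedFDeriv ℝ p f y) := by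
    rw [intervalIntegral.integral_sub (hcont.intervalIntegrable _ _) (by simp)]
    simp [averagedTensor]
  rw [h]
  have := intervalIntegral.norm_integral_le_of_norm_le_const (a := (0 : ℝ)) (b := 1) (C := M)
    (f := fun t => iteratedFDeriv ℝ p f (x + t • s) - iteratedFDeriv ℝ p f y)
    (fun t ht => hM t (by rw [Set.uIoc_of_le zero_le_one] at ht; exact ⟨ht.1.le, ht.2⟩))
  simpa using this

end Averaged

/-! ### Scalar recurrences -/

/-- Recurrences satisfied by the function gap `φ`, the gradient norm `g`, the negative curvature
`b`, the regularization parameter `σ`, the step length `r` and the sum `V` of the previous step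
lengths in a window of fixed size. -/
structure StepRecurrence (p : ℕ) (K M G σ₀ : ℝ) (φ g b σ r V : ℕ → ℝ) : Prop where
  gap_nonneg : ∀ k, 0 ≤ φ k
  step_nonneg : ∀ k, 0 ≤ r k
  window_nonneg : ∀ k, 0 ≤ V k
  gap_zero : φ 0 ≤ G
  grad_zero : g 0 ≤ G
  curv_zero : b 0 ≤ G
  sigma_zero : σ 0 = σ₀
  sigma_succ : ∀ k, σ (k + 1) = σ k + σ k * r k ^ (p + 1)
  window_le : ∀ k, V k ^ (p + 1) ≤ M * (1 + ∑ j ∈ Finset.range k, r j ^ (p + 1))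
  window_sum_le : ∀ k, ∑ j ∈ Finset.range k, (r j + V j) ^ (p + 1) ≤
    M * (1 + ∑ j ∈ Finset.range k, r j ^ (p + 1))
  gap_succ : ∀ k, φ (k + 1) ≤
    φ k - σ k / ((p + 1).factorial : ℝ) * r k ^ (p + 1) + K * (r k + V k) ^ (p + 1)
  grad_succ : ∀ k, g (k + 1) ≤ K * (1 + σ k) * (r k + V k) ^ p
  curv_succ : ∀ k, b (k + 1) ≤ K * (1 + σ k) * (r k + V k) ^ (p - 1)
  step_le : ∀ k, 1 ≤ r k → σ k * r k ≤ K * (1 + g k + b k + V k)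

theorem le_one_add_of_pow_succ_le {y Q : ℝ} {p : ℕ} (hQ : 0 ≤ Q) (h : y ^ (p + 1) ≤ Q) :
    y ≤ 1 + Q := by
  rcases le_total y 1 with hy | hy
  · linarith
  · linarith [le_self_pow₀ hy p.add_one_ne_zero]

theorem rpow_le_one_add {B a : ℝ} (hB : 0 ≤ B) (ha0 : 0 ≤ a) (ha1 : a ≤ 1) : B ^ a ≤ 1 + B := by
  rcases le_total B 1 with h | h
  · linarith [Real.rpow_le_one hB h ha0]
  · have := Real.rpow_le_rpow_of_exponent_le h ha1
    rw [Real.rpow_one] at this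
    linarith

namespace StepRecurrence

variable {p : ℕ} {K M G σ₀ : ℝ} {φ g b σ r V : ℕ → ℝ}

theorem sigma_eq (h : StepRecurrence p K M G σ₀ φ g b σ r V) (k : ℕ) :
    σ k = σ₀ + ∑ j ∈ Finset.range k, σ j * r j ^ (p + 1) := by
  induction k with
  | zero => simp [h.sigma_zero]
  | succ k ih => rw [h.sigma_succ, Finset.sum_range_succ, ← add_assoc, ← ih]

theorem sigma_lower (h : StepRecurrence p K M G σ₀ φ g b σ r V) (hσ₀ : 0 < σ₀) (k : ℕ) :
    σ₀ ≤ σ k := by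
  induction k with
  | zero => exact h.sigma_zero.ge
  | succ k ih =>
    rw [h.sigma_succ]
    have : 0 ≤ σ k * r k ^ (p + 1) :=
      mul_nonneg (hσ₀.le.trans ih) (pow_nonneg (h.step_nonneg k) _)
    linarith

theorem sigma_mono (h : StepRecurrence p K M G σ₀ φ g b σ r V) (hσ₀ : 0 < σ₀) : Monotone σ := by
  refine monotone_nat_of_le_succ fun k => ?_
  rw [h.sigma_succ]
  have : 0 ≤ σ k * r k ^ (p + 1) :=
    mul_nonneg (hσ₀.le.trans (h.sigma_lower hσ₀ k)) (pow_nonneg (h.step_nonneg k) _)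
  linarith

/-- Each step adds `σ j * r j ^ (p + 1)`, at least `σ₀ * r j ^ (p + 1)`, to σ; a bound on σ thus
bounds the steps in total. -/
theorem sum_step_pow_le (h : StepRecurrence p K M G σ₀ φ g b σ r V) (hσ₀ : 0 < σ₀) (k : ℕ) :
    ∑ j ∈ Finset.range k, r j ^ (p + 1) ≤ σ k / σ₀ := by
  rw [le_div_iff₀ hσ₀, mul_comm, Finset.mul_sum, h.sigma_eq k]
  have : ∑ j ∈ Finset.range k, σ₀ * r j ^ (p + 1) ≤ ∑ j ∈ Finset.range k, σ j * r j ^ (p + 1) :=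
    Finset.sum_le_sum fun j _ =>
      mul_le_mul_of_nonneg_right (h.sigma_lower hσ₀ j) (pow_nonneg (h.step_nonneg j) _)
  linarith

theorem gap_le (h : StepRecurrence p K M G σ₀ φ g b σ r V) (k : ℕ) :
    φ k ≤ G - (∑ j ∈ Finset.range k, σ j * r j ^ (p + 1)) / ((p + 1).factorial : ℝ) +
      K * ∑ j ∈ Finset.range k, (r j + V j) ^ (p + 1) := by
  induction k with
  | zero => simpa using h.gap_zero
  | succ k ih =>
    have := h.gap_succ k
    rw [Finset.sum_range_succ, Finset.sum_range_succ, add_div, mul_add]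
    have h2 : σ k / ((p + 1).factorial : ℝ) * r k ^ (p + 1) =
      σ k * r k ^ (p + 1) / ((p + 1).factorial : ℝ) := by ring
    linarith

theorem sum_sigma_sub_le (h : StepRecurrence p K M G σ₀ φ g b σ r V) (hK : 0 ≤ K) (k : ℕ) :
    ∑ j ∈ Finset.range k, (σ j - (p + 1).factorial * K * M) * r j ^ (p + 1) ≤
      (p + 1).factorial * (G + K * M) := by
  have hfac : (0 : ℝ) < (p + 1).factorial := by positivity
  have h1 := h.gap_le k
  have h2 := mul_le_mul_of_nonneg_left (h.window_sum_le k) hK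
  have h3 := h.gap_nonneg k
  have h4 : (∑ j ∈ Finset.range k, σ j * r j ^ (p + 1)) / ((p + 1).factorial : ℝ) ≤
      G + K * (M * (1 + ∑ j ∈ Finset.range k, r j ^ (p + 1))) := by linarith
  rw [div_le_iff₀ hfac] at h4
  simp only [sub_mul, Finset.sum_sub_distrib, ← Finset.mul_sum]
  nlinarith

/-- While the regularization parameter is bounded, so are the steps. -/
theorem exists_step_bound (p : ℕ) {K M G σ₀ A : ℝ} (hK : 0 ≤ K) (hM : 0 ≤ M) (hG : 0 ≤ G)
    (hσ₀ : 0 < σ₀) (hA : 0 ≤ A) :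
    ∃ R : ℝ, 0 ≤ R ∧ ∀ φ g b σ r V : ℕ → ℝ, StepRecurrence p K M G σ₀ φ g b σ r V →
      ∀ k, σ k ≤ A → r k ≤ R := by
  set Q := M * (1 + A / σ₀) with hQdef
  have hQ : 0 ≤ Q := by positivity
  set D := K * (1 + A) * (1 + Q) ^ p with hD
  have hD0 : 0 ≤ D := by positivity
  refine ⟨1 + K * (1 + (G + D) + (G + D) + (1 + Q)) / σ₀, by positivity, ?_⟩
  intro φ g b σ r V h k hk
  have hsum : ∀ i ≤ k, M * (1 + ∑ j ∈ Finset.range i, r j ^ (p + 1)) ≤ Q := by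
    intro i hi
    have h1 := h.sum_step_pow_le hσ₀ i
    have h2 : σ i ≤ A := (h.sigma_mono hσ₀ hi).trans hk
    have h3 : σ i / σ₀ ≤ A / σ₀ := by gcongr
    exact mul_le_mul_of_nonneg_left (by linarith) hM
  have hV : V k ≤ 1 + Q := le_one_add_of_pow_succ_le hQ ((h.window_le k).trans (hsum k le_rfl))
  have hgb : g k ≤ G + D ∧ b k ≤ G + D := by
    cases k with
    | zero => exact ⟨by linarith [h.grad_zero], by linarith [h.curv_zero]⟩
    | succ k =>
      have hW0 : 0 ≤ r k + V k := add_nonneg (h.step_nonneg k) (h.window_nonneg k)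
      -- The step before the current one already contributed to σ at index `k + 1`, so it is one
      -- term of a bounded sum. The current step is not, and needs `step_le`.
      have hW : r k + V k ≤ 1 + Q := by
        refine le_one_add_of_pow_succ_le (p := p) hQ ?_
        refine le_trans ?_ ((h.window_sum_le (k + 1)).trans (hsum _ le_rfl))
        rw [Finset.sum_range_succ]
        have : 0 ≤ ∑ j ∈ Finset.range k, (r j + V j) ^ (p + 1) := Finset.sum_nonneg fun j _ =>
          pow_nonneg (add_nonneg (h.step_nonneg j) (h.window_nonneg j)) _
        linarith
      have hσk : σ k ≤ A := (h.sigma_mono hσ₀ k.le_succ).trans hk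
      have hσk0 : 0 ≤ σ k := hσ₀.le.trans (h.sigma_lower hσ₀ k)
      have h1 : K * (1 + σ k) * (r k + V k) ^ p ≤ D := by
        rw [hD]; gcongr
      have h2 : K * (1 + σ k) * (r k + V k) ^ (p - 1) ≤ D := by
        rw [hD]
        have : (r k + V k) ^ (p - 1) ≤ (1 + Q) ^ p :=
          (pow_le_pow_left₀ hW0 hW _).trans (pow_le_pow_right₀ (by linarith) (Nat.sub_le p 1))
        gcongr
      exact ⟨by linarith [h.grad_succ k], by linarith [h.curv_succ k]⟩
  rcases le_total (r k) 1 with hr | hr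
  · have : 0 ≤ K * (1 + (G + D) + (G + D) + (1 + Q)) / σ₀ := by positivity
    linarith
  · have h1 := h.step_le k hr
    have h2 : σ₀ * r k ≤ σ k * r k :=
      mul_le_mul_of_nonneg_right (h.sigma_lower hσ₀ k) (h.step_nonneg k)
    have h3 : K * (1 + g k + b k + V k) ≤ K * (1 + (G + D) + (G + D) + (1 + Q)) :=
      mul_le_mul_of_nonneg_left (by linarith [hgb.1, hgb.2]) hK
    have h4 : r k ≤ K * (1 + (G + D) + (G + D) + (1 + Q)) / σ₀ := by
      rw [le_div_iff₀ hσ₀]; linarith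
    linarith

/-- The regularization parameter is bounded. -/
theorem exists_sigma_bound (p : ℕ) {K M G σ₀ : ℝ} (hK : 0 ≤ K) (hM : 0 ≤ M) (hG : 0 ≤ G)
    (hσ₀ : 0 < σ₀) :
    ∃ S : ℝ, 0 ≤ S ∧ ∀ φ g b σ r V : ℕ → ℝ, StepRecurrence p K M G σ₀ φ g b σ r V →
      ∀ k, σ k ≤ S := by
  set A := (p + 1).factorial * K * M with hAdef
  have hA : 0 ≤ A := by positivity
  obtain ⟨R, hR0, hR⟩ := exists_step_bound p hK hM hG hσ₀ (A := 2 * A + σ₀) (by positivity)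
  set S₁ := (2 * A + σ₀) * (1 + R ^ (p + 1)) with hS₁
  have hS₁0 : 0 ≤ S₁ := by positivity
  set c := (p + 1).factorial * (G + K * M) with hc
  have hc0 : 0 ≤ c := by positivity
  refine ⟨2 * A + σ₀ + 2 * (S₁ / 2 + A * (S₁ / σ₀) + c), by positivity, ?_⟩
  intro φ g b σ r V h
  -- The left side of the second alternative does not increase while σ exceeds the threshold. The
  -- summand `σ₀` in the threshold makes the first alternative hold at index 0.
  have hclaim : ∀ k, σ k ≤ 2 * A + σ₀ ∨
      σ k / 2 - ∑ j ∈ Finset.range k, (σ j - A) * r j ^ (p + 1) ≤ S₁ / 2 + A * (S₁ / σ₀) := by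
    intro k
    induction k with
    | zero => left; rw [h.sigma_zero]; linarith
    | succ k ih =>
      right
      have hr0 := h.step_nonneg k
      have hrq : 0 ≤ r k ^ (p + 1) := pow_nonneg hr0 _
      by_cases hk : σ k ≤ 2 * A + σ₀
      -- Last index below the threshold, or still below it afterwards: the bounded step gives `σ (k
      -- + 1) ≤ S₁`, and the negative part of the sum costs at most `A * (S₁ / σ₀)`.
      · have hrk := hR φ g b σ r V h k hk
        have h1 : σ (k + 1) ≤ S₁ := by
          rw [h.sigma_succ]
          have : r k ^ (p + 1) ≤ R ^ (p + 1) := pow_le_pow_left₀ hr0 hrk _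
          calc σ k + σ k * r k ^ (p + 1) = σ k * (1 + r k ^ (p + 1)) := by ring
            _ ≤ S₁ := by rw [hS₁]; gcongr
        have h2 := h.sum_step_pow_le hσ₀ (k + 1)
        have h3 : σ (k + 1) / σ₀ ≤ S₁ / σ₀ := by gcongr
        have h4 : 0 ≤ ∑ j ∈ Finset.range (k + 1), σ j * r j ^ (p + 1) :=
          Finset.sum_nonneg fun j _ => mul_nonneg (hσ₀.le.trans (h.sigma_lower hσ₀ j))
            (pow_nonneg (h.step_nonneg j) _)
        have h5 := mul_le_mul_of_nonneg_left (h2.trans h3) hA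
        simp only [sub_mul, Finset.sum_sub_distrib, ← Finset.mul_sum]
        linarith
      · have ih := ih.resolve_left hk
        rw [Finset.sum_range_succ, h.sigma_succ]
        have : 0 ≤ (σ k / 2 - A) * r k ^ (p + 1) := mul_nonneg (by linarith) hrq
        linarith
  intro k
  have hsum := h.sum_sigma_sub_le hK k
  have hS : 0 ≤ A * (S₁ / σ₀) := by positivity
  rcases hclaim k with h1 | h1 <;> linarith

/-- At some iterate among the first ones, the gradient and the negative curvature are both small. -/
theorem exists_rate {p : ℕ} (hp : 1 ≤ p) {K M G σ₀ : ℝ} (hK : 0 ≤ K) (hM : 0 ≤ M) (hG : 0 ≤ G)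
    (hσ₀ : 0 < σ₀) :
    ∃ C : ℝ, 0 ≤ C ∧ ∀ φ g b σ r V : ℕ → ℝ, StepRecurrence p K M G σ₀ φ g b σ r V →
      ∀ k : ℕ, ∃ j ≤ k, g (j + 1) ≤ C * ((k : ℝ) + 1) ^ (-((p : ℝ) / ((p : ℝ) + 1))) ∧
        b (j + 1) ≤ C * ((k : ℝ) + 1) ^ (-(((p : ℝ) - 1) / ((p : ℝ) + 1))) := by
  obtain ⟨S, hS0, hS⟩ := exists_sigma_bound p hK hM hG hσ₀
  set B := M * (1 + S / σ₀) with hB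
  have hB0 : 0 ≤ B := by positivity
  refine ⟨K * (1 + S) * (1 + B), by positivity, ?_⟩
  intro φ g b σ r V h k
  have hk : (0 : ℝ) < (k : ℝ) + 1 := by positivity
  have hsum : ∑ j ∈ Finset.range (k + 1), (r j + V j) ^ (p + 1) ≤
      ∑ _j ∈ Finset.range (k + 1), B / ((k : ℝ) + 1) := by
    rw [Finset.sum_const, Finset.card_range, nsmul_eq_mul]
    push_cast
    rw [mul_div_cancel₀ _ hk.ne']
    refine (h.window_sum_le (k + 1)).trans ?_
    have h1 := h.sum_step_pow_le hσ₀ (k + 1)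
    have h3 : σ (k + 1) / σ₀ ≤ S / σ₀ := by gcongr; exact hS φ g b σ r V h _
    exact mul_le_mul_of_nonneg_left (by linarith) hM
  obtain ⟨j, hj, hjB⟩ := Finset.exists_le_of_sum_le (by simp) hsum
  refine ⟨j, by simpa [Nat.lt_succ_iff] using hj, ?_⟩
  set W := r j + V j with hW
  have hW0 : 0 ≤ W := add_nonneg (h.step_nonneg j) (h.window_nonneg j)
  have hp0 : (0 : ℝ) < (p : ℝ) + 1 := by positivity
  have hp1 : (1 : ℝ) ≤ p := by exact_mod_cast hp
  have hpow : ∀ i : ℕ, i ≤ p →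
      W ^ i ≤ (1 + B) * ((k : ℝ) + 1) ^ (-((i : ℝ) / ((p : ℝ) + 1))) := by
    intro i hi
    have hi1 : (i : ℝ) ≤ p := by exact_mod_cast hi
    have e1 : W ^ i = (W ^ (p + 1)) ^ ((i : ℝ) / ((p : ℝ) + 1)) := by
      rw [← Real.rpow_natCast W (p + 1), ← Real.rpow_mul hW0, ← Real.rpow_natCast W i]
      congr 1
      push_cast
      field_simp
    have hexp0 : 0 ≤ (i : ℝ) / ((p : ℝ) + 1) := by positivity
    rw [e1]
    calc _ ≤ (B / ((k : ℝ) + 1)) ^ ((i : ℝ) / ((p : ℝ) + 1)) :=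
          Real.rpow_le_rpow (pow_nonneg hW0 _) hjB hexp0
      _ = B ^ ((i : ℝ) / ((p : ℝ) + 1)) * ((k : ℝ) + 1) ^ (-((i : ℝ) / ((p : ℝ) + 1))) := by
          rw [Real.div_rpow hB0 hk.le, Real.rpow_neg hk.le, div_eq_mul_inv]
      _ ≤ _ := by
          refine mul_le_mul_of_nonneg_right ?_ (Real.rpow_nonneg hk.le _)
          refine rpow_le_one_add hB0 hexp0 ?_
          rw [div_le_one hp0]; linarith
  have hσj : σ j ≤ S := hS φ g b σ r V h j
  have hσj0 : 0 ≤ σ j := hσ₀.le.trans (h.sigma_lower hσ₀ j)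
  have hcoef : K * (1 + σ j) ≤ K * (1 + S) := by gcongr
  constructor
  · calc g (j + 1) ≤ K * (1 + σ j) * W ^ p := h.grad_succ j
      _ ≤ K * (1 + S) * ((1 + B) * ((k : ℝ) + 1) ^ (-((p : ℝ) / ((p : ℝ) + 1)))) :=
          mul_le_mul hcoef (hpow p le_rfl) (pow_nonneg hW0 _) (by positivity)
      _ = _ := by ring
  · have h1 := hpow (p - 1) (Nat.sub_le p 1)
    rw [Nat.cast_sub hp, Nat.cast_one] at h1
    calc b (j + 1) ≤ K * (1 + σ j) * W ^ (p - 1) := h.curv_succ j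
      _ ≤ K * (1 + S) * ((1 + B) * ((k : ℝ) + 1) ^ (-(((p : ℝ) - 1) / ((p : ℝ) + 1)))) :=
          mul_le_mul hcoef h1 (pow_nonneg hW0 _) (by positivity)
      _ = _ := by ring

end StepRecurrence

/-- Simultaneous rates turn into an iteration complexity bound. -/
theorem exists_index_of_rates {a₁ a₂ C ε₁ ε₂ : ℝ} (ha₁ : 0 < a₁) (ha₂ : 0 < a₂) (hC : 0 < C)
    (hε₁ : 0 < ε₁) (hε₂ : 0 < ε₂) {g b : ℕ → ℝ} (hg0 : g 0 ≤ C) (hb0 : b 0 ≤ C)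
    (h : ∀ k : ℕ, ∃ j ≤ k, g (j + 1) ≤ C * ((k : ℝ) + 1) ^ (-a₁) ∧
      b (j + 1) ≤ C * ((k : ℝ) + 1) ^ (-a₂)) :
    ∃ j : ℕ, (j : ℝ) ≤ 2 * (C ^ a₁⁻¹ + C ^ a₂⁻¹) * max (ε₁ ^ (-a₁⁻¹)) (ε₂ ^ (-a₂⁻¹)) ∧
      g j ≤ ε₁ ∧ b j ≤ ε₂ := by
  set Y := (C ^ a₁⁻¹ + C ^ a₂⁻¹) * max (ε₁ ^ (-a₁⁻¹)) (ε₂ ^ (-a₂⁻¹)) with hY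
  have hmul : 2 * (C ^ a₁⁻¹ + C ^ a₂⁻¹) * max (ε₁ ^ (-a₁⁻¹)) (ε₂ ^ (-a₂⁻¹)) = 2 * Y := by
    rw [hY]; ring
  rw [hmul]
  have hC1 : 0 < C ^ a₁⁻¹ := Real.rpow_pos_of_pos hC _
  have hC2 : 0 < C ^ a₂⁻¹ := Real.rpow_pos_of_pos hC _
  have hm1 : 0 < ε₁ ^ (-a₁⁻¹) := Real.rpow_pos_of_pos hε₁ _
  have hm2 : 0 < ε₂ ^ (-a₂⁻¹) := Real.rpow_pos_of_pos hε₂ _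
  have hY0 : 0 < Y := mul_pos (by positivity) (lt_max_of_lt_left hm1)
  have key : ∀ a ε : ℝ, 0 < a → 0 < ε → C ^ a⁻¹ * ε ^ (-a⁻¹) ≤ Y → ∀ y : ℝ, Y ≤ y →
      C * y ^ (-a) ≤ ε := by
    intro a ε ha hε hle y hy
    have hy0 : 0 < y := hY0.trans_le hy
    have h1 : (C / ε) ^ a⁻¹ ≤ y := by
      rw [Real.div_rpow hC.le hε.le, div_eq_mul_inv, ← Real.rpow_neg hε.le]
      exact hle.trans hy
    have h2 : C / ε ≤ y ^ a := by
      have := Real.rpow_le_rpow (Real.rpow_nonneg (by positivity) _) h1 ha.le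
      rwa [← Real.rpow_mul (by positivity), inv_mul_cancel₀ ha.ne', Real.rpow_one] at this
    rw [Real.rpow_neg hy0.le, ← div_eq_mul_inv, div_le_iff₀ (Real.rpow_pos_of_pos hy0 _)]
    rw [div_le_iff₀ hε] at h2
    linarith
  have hle1 : C ^ a₁⁻¹ * ε₁ ^ (-a₁⁻¹) ≤ Y :=
    mul_le_mul (by linarith) (le_max_left _ _) hm1.le (by positivity)
  have hle2 : C ^ a₂⁻¹ * ε₂ ^ (-a₂⁻¹) ≤ Y :=
    mul_le_mul (by linarith) (le_max_right _ _) hm2.le (by positivity)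
  -- For `Y < 1` the bound may allow no positive index, but then `C ≤ ε₁` and `C ≤ ε₂`, so index 0
  -- works. Otherwise the index is at most `⌊Y⌋₊ + 1 ≤ 2 * Y`, whence the factor 2.
  rcases lt_or_ge Y 1 with hY1 | hY1
  · have h1 := key a₁ ε₁ ha₁ hε₁ hle1 1 hY1.le
    have h2 := key a₂ ε₂ ha₂ hε₂ hle2 1 hY1.le
    rw [Real.one_rpow, mul_one] at h1 h2
    exact ⟨0, by simpa using hY0.le, hg0.trans h1, hb0.trans h2⟩
  · obtain ⟨j, hj, hgj, hbj⟩ := h ⌊Y⌋₊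
    have hfl : Y ≤ (⌊Y⌋₊ : ℝ) + 1 := (Nat.lt_floor_add_one Y).le
    refine ⟨j + 1, ?_, hgj.trans (key a₁ ε₁ ha₁ hε₁ hle1 _ hfl),
      hbj.trans (key a₂ ε₂ ha₂ hε₂ hle2 _ hfl)⟩
    have h1 : (j : ℝ) ≤ (⌊Y⌋₊ : ℝ) := by exact_mod_cast hj
    have h2 := Nat.floor_le hY0.le
    push_cast
    linarith

variable {n : ℕ}

/-! ### Windows of step lengths -/

/-- The sum of the lengths of the `N` steps before the step `k`. -/
def window (s : ℕ → Vec n) (N : ℕ) (k : ℤ) : ℝ :=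
  ∑ i ∈ Finset.range N, stepLength s (k - ((i : ℤ) + 1))

theorem stepLength_natCast (s : ℕ → Vec n) (k : ℕ) : stepLength s (k : ℤ) = ‖s k‖ := by
  simp [stepLength]

theorem stepLength_nonneg (s : ℕ → Vec n) (j : ℤ) : 0 ≤ stepLength s j := by
  unfold stepLength; split_ifs <;> simp

theorem window_nonneg (s : ℕ → Vec n) (N : ℕ) (k : ℤ) : 0 ≤ window s N k :=
  Finset.sum_nonneg fun _ _ => stepLength_nonneg s _

theorem window_mono (s : ℕ → Vec n) {N N' : ℕ} (h : N ≤ N') (k : ℤ) :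
    window s N k ≤ window s N' k :=
  Finset.sum_le_sum_of_subset_of_nonneg (by simpa using h) fun _ _ _ => stepLength_nonneg s _

theorem window_succ_succ (s : ℕ → Vec n) (N k : ℕ) :
    window s (N + 1) ((k : ℤ) + 1) = ‖s k‖ + window s N k := by
  rw [window, Finset.sum_range_succ', window, add_comm]
  congr 1
  · rw [← stepLength_natCast]; congr 1; push_cast; ring
  · refine Finset.sum_congr rfl fun i _ => ?_
    congr 1; push_cast; ring

theorem sum_Icc_stepLength (s : ℕ → Vec n) (N : ℕ) (k : ℤ) :
    ∑ i ∈ Finset.Icc 1 N, stepLength s (k - (i : ℤ)) = window s N k := by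
  induction N with
  | zero => simp [window]
  | succ N ih =>
    rw [Finset.sum_Icc_succ_top (by omega), ih, window, window, Finset.sum_range_succ]
    push_cast
    rfl

theorem stepLength_pow_le (s : ℕ → Vec n) (q k : ℕ) {j : ℤ} (hj : j < k) :
    stepLength s j ^ q ≤ 1 + ∑ i ∈ Finset.range k, ‖s i‖ ^ q := by
  have h0 : ∀ i ∈ Finset.range k, 0 ≤ ‖s i‖ ^ q := fun i _ => by positivity
  rcases lt_or_ge j 0 with h | h
  · have := Finset.sum_nonneg h0
    simp [stepLength, not_le.mpr h]
    linarith
  · obtain ⟨i, rfl⟩ := Int.eq_ofNat_of_zero_le h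
    have := Finset.single_le_sum h0 (Finset.mem_range.mpr (by exact_mod_cast hj : i < k))
    rw [stepLength_natCast]
    linarith

theorem window_pow_le (s : ℕ → Vec n) (N k p : ℕ) :
    window s N k ^ (p + 1) ≤
      (N : ℝ) ^ (p + 1) * (1 + ∑ i ∈ Finset.range k, ‖s i‖ ^ (p + 1)) := by
  have h1 := pow_sum_le_card_mul_sum_pow (s := Finset.range N)
    (f := fun i : ℕ => stepLength s ((k : ℤ) - ((i : ℤ) + 1)))
    (fun i _ => stepLength_nonneg s _) p
  rw [Finset.card_range] at h1
  refine h1.trans ?_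
  have h2 : ∑ i ∈ Finset.range N, stepLength s ((k : ℤ) - ((i : ℤ) + 1)) ^ (p + 1) ≤
      ∑ _i ∈ Finset.range N, (1 + ∑ i ∈ Finset.range k, ‖s i‖ ^ (p + 1)) :=
    Finset.sum_le_sum fun i _ => stepLength_pow_le s (p + 1) k (by omega)
  rw [Finset.sum_const, Finset.card_range, nsmul_eq_mul] at h2
  calc _ ≤ (N : ℝ) ^ p * (N * (1 + ∑ i ∈ Finset.range k, ‖s i‖ ^ (p + 1))) := by gcongr
    _ = _ := by ring

/-- Shifting by `i` brings in at most `i` negative indices, each of default length 1. -/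
theorem sum_stepLength_shift_le (s : ℕ → Vec n) (q k i : ℕ) :
    ∑ j ∈ Finset.range k, stepLength s ((j : ℤ) - i) ^ q ≤
      i + ∑ j ∈ Finset.range k, ‖s j‖ ^ q := by
  induction i with
  | zero => simp [stepLength_natCast]
  | succ i ih =>
    have h1 : ∑ j ∈ Finset.range k, stepLength s ((j : ℤ) - (i + 1 : ℕ)) ^ q ≤
        ∑ j ∈ Finset.range (k + 1), stepLength s ((j : ℤ) - (i + 1 : ℕ)) ^ q := by
      rw [Finset.sum_range_succ]
      have := pow_nonneg (stepLength_nonneg s ((k : ℤ) - (i + 1 : ℕ))) q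
      linarith
    rw [Finset.sum_range_succ'] at h1
    have h2 : stepLength s (((0 : ℕ) : ℤ) - (i + 1 : ℕ)) = 1 := by
      rw [stepLength, if_neg (by push_cast; omega)]
    have h3 : ∀ j : ℕ, ((j + 1 : ℕ) : ℤ) - (i + 1 : ℕ) = (j : ℤ) - i := fun j => by
      push_cast; ring
    rw [h2, one_pow] at h1
    simp only [h3] at h1
    push_cast at h1 ⊢
    linarith

/-- The power mean inequality costs `(N + 1) ^ p`; exchanging the sums leaves `N + 1` shifted sums,
each at most `N + S ≤ (N + 1) * (1 + S)`. -/
theorem sum_window_pow_le (s : ℕ → Vec n) (N k p : ℕ) :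
    ∑ j ∈ Finset.range k, (‖s j‖ + window s N j) ^ (p + 1) ≤
      ((N : ℝ) + 1) ^ (p + 2) * (1 + ∑ i ∈ Finset.range k, ‖s i‖ ^ (p + 1)) := by
  set S := ∑ i ∈ Finset.range k, ‖s i‖ ^ (p + 1) with hS
  have hS0 : 0 ≤ S := Finset.sum_nonneg fun i _ => by positivity
  have h1 : ∀ j ∈ Finset.range k, (‖s j‖ + window s N j) ^ (p + 1) ≤
      ((N : ℝ) + 1) ^ p * ∑ i ∈ Finset.range (N + 1), stepLength s ((j : ℤ) - i) ^ (p + 1) := by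
    intro j _
    rw [← window_succ_succ]
    have h := pow_sum_le_card_mul_sum_pow (s := Finset.range (N + 1))
      (f := fun i : ℕ => stepLength s ((j : ℤ) - i)) (fun i _ => stepLength_nonneg s _) p
    rw [Finset.card_range] at h
    push_cast at h
    refine le_trans (le_of_eq ?_) h
    congr 1
    refine Finset.sum_congr rfl fun i _ => ?_
    congr 1; ring
  refine (Finset.sum_le_sum h1).trans ?_
  rw [← Finset.mul_sum, Finset.sum_comm]
  have h2 : ∑ i ∈ Finset.range (N + 1), ∑ j ∈ Finset.range k,
      stepLength s ((j : ℤ) - i) ^ (p + 1) ≤ ∑ _i ∈ Finset.range (N + 1), ((N : ℝ) + S) := by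
    refine Finset.sum_le_sum fun i hi => (sum_stepLength_shift_le s (p + 1) k i).trans ?_
    have : (i : ℝ) ≤ N := by exact_mod_cast Nat.lt_succ_iff.mp (Finset.mem_range.mp hi)
    linarith
  rw [Finset.sum_const, Finset.card_range, nsmul_eq_mul] at h2
  push_cast at h2
  have hN : (0 : ℝ) ≤ N := by positivity
  calc _ ≤ ((N : ℝ) + 1) ^ p * (((N : ℝ) + 1) * ((N : ℝ) + S)) := by gcongr
    _ ≤ ((N : ℝ) + 1) ^ p * (((N : ℝ) + 1) * (((N : ℝ) + 1) * (1 + S))) := by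
        gcongr
        nlinarith
    _ = _ := by ring

/-! ### The error of the tensor approximation -/

/-- Passing through the averaged tensor, the error e satisfies e_{k+1} ≤ κC (e_k + L r_k) + L r_k ≤
κC e_k + 2 κC L r_k, using κC ≥ 1. The bound solves this recurrence along a cycle; the window grows
by one with each update so that it always reaches back to the steps used at the restart. -/
theorem TensorCondition.error_le_window {p m : ℕ} {κA κB κC L : ℝ} {f : Vec n → ℝ}
    {x s : ℕ → Vec n} {T : ℕ → Tensor n p} (h : TensorCondition p m κA κB κC f x s T)
    (hm : 1 ≤ m) (hκA : 0 ≤ κA) (hκC : 1 ≤ κC) (hL : 0 ≤ L) (hf : ContDiff ℝ p f)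
    (hlip : ∀ x y, ‖iteratedFDeriv ℝ p f x - iteratedFDeriv ℝ p f y‖ ≤ L * ‖x - y‖)
    (hx : ∀ k, x (k + 1) = x k + s k) (k : ℕ) :
    ‖T k - iteratedFDeriv ℝ p f (x k)‖ ≤
      κC ^ (k % m) * (κA + 2 * ((k % m : ℕ) : ℝ) * L) * window s (m + k % m) k := by
  have hrestart : ∀ k, k % m = 0 → ‖T k - iteratedFDeriv ℝ p f (x k)‖ ≤
      κC ^ (k % m) * (κA + 2 * ((k % m : ℕ) : ℝ) * L) * window s (m + k % m) k := by
    intro k hk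
    have h1 := (h.restart k hk).trans (min_le_left _ _)
    rw [sum_Icc_stepLength] at h1
    simpa [hk] using h1
  induction k with
  | zero => exact hrestart 0 (Nat.zero_mod m)
  | succ k ih =>
    by_cases hk : (k + 1) % m = 0
    · exact hrestart _ hk
    have hmod : (k + 1) % m = k % m + 1 := by
      have hlt := Nat.mod_lt k hm
      have h1 : (k + 1) % m = (k % m + 1) % m := by simp
      rcases Nat.lt_or_ge (k % m + 1) m with h2 | h2
      · rw [h1, Nat.mod_eq_of_lt h2]
      · exact absurd (by rw [h1, show k % m + 1 = m by omega, Nat.mod_self]) hk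
    have hr : 0 ≤ ‖s k‖ := norm_nonneg _
    have h1 : ‖averagedTensor p f (x k) (s k) - iteratedFDeriv ℝ p f (x k)‖ ≤ L * ‖s k‖ := by
      refine norm_averagedTensor_sub_le hf _ _ _ fun t ht => (hlip _ _).trans ?_
      rw [add_sub_cancel_left, norm_smul, Real.norm_of_nonneg ht.1]
      have := mul_le_of_le_one_left hr ht.2
      gcongr
    have h2 : ‖averagedTensor p f (x k) (s k) - iteratedFDeriv ℝ p f (x (k + 1))‖ ≤
        L * ‖s k‖ := by
      refine norm_averagedTensor_sub_le hf _ _ _ fun t ht => (hlip _ _).trans ?_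
      have he : x k + t • s k - x (k + 1) = (t - 1) • s k := by
        rw [hx, sub_smul, one_smul]; abel
      rw [he, norm_smul, Real.norm_of_nonpos (by linarith [ht.2])]
      have := mul_le_of_le_one_left hr (by linarith [ht.1] : -(t - 1) ≤ 1)
      gcongr
    have h3 := h.update k hk
    have h4 : ‖T k - averagedTensor p f (x k) (s k)‖ ≤
        ‖T k - iteratedFDeriv ℝ p f (x k)‖ + L * ‖s k‖ := by
      refine (norm_sub_le_norm_sub_add_norm_sub _ (iteratedFDeriv ℝ p f (x k)) _).trans ?_
      rw [norm_sub_rev (iteratedFDeriv ℝ p f (x k))]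
      linarith
    have h5 := norm_sub_le_norm_sub_add_norm_sub (T (k + 1)) (averagedTensor p f (x k) (s k))
      (iteratedFDeriv ℝ p f (x (k + 1)))
    have hκC0 : 0 ≤ κC := by linarith
    have h6 : κC * ‖T k - averagedTensor p f (x k) (s k)‖ ≤
        κC * (‖T k - iteratedFDeriv ℝ p f (x k)‖ + L * ‖s k‖) := by gcongr
    have h7 : L * ‖s k‖ ≤ κC * (L * ‖s k‖) := le_mul_of_one_le_left (by positivity) hκC
    rw [hmod, ← add_assoc]
    push_cast
    rw [window_succ_succ]
    set j := k % m
    have hw := window_nonneg s (m + j) k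
    have hpow : 1 ≤ κC ^ j := one_le_pow₀ hκC
    calc ‖T (k + 1) - iteratedFDeriv ℝ p f (x (k + 1))‖
        ≤ κC * ‖T k - iteratedFDeriv ℝ p f (x k)‖ + 2 * κC * L * ‖s k‖ := by linarith
      _ ≤ κC * (κC ^ j * (κA + 2 * (j : ℝ) * L) * window s (m + j) k) +
          κC ^ j * (2 * κC * L * ‖s k‖) := by
          have : 2 * κC * L * ‖s k‖ ≤ κC ^ j * (2 * κC * L * ‖s k‖) :=
            le_mul_of_one_le_left (by positivity) hpow
          gcongr
      _ ≤ _ := by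
          have h8 : 0 ≤ κC ^ j * κC * (κA + 2 * (j : ℝ) * L) * ‖s k‖ := by positivity
          have h9 : 0 ≤ κC ^ j * κC * (2 * L) * window s (m + j) k := by positivity
          rw [pow_succ]
          linarith

/-- A bound for the tensor error that does not depend on the position of `k` in its cycle. -/
theorem TensorCondition.error_le {p m : ℕ} {κA κB κC L : ℝ} {f : Vec n → ℝ}
    {x s : ℕ → Vec n} {T : ℕ → Tensor n p} (h : TensorCondition p m κA κB κC f x s T)
    (hm : 1 ≤ m) (hκA : 0 ≤ κA) (hκC : 1 ≤ κC) (hL : 0 ≤ L) (hf : ContDiff ℝ p f)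
    (hlip : ∀ x y, ‖iteratedFDeriv ℝ p f x - iteratedFDeriv ℝ p f y‖ ≤ L * ‖x - y‖)
    (hx : ∀ k, x (k + 1) = x k + s k) (k : ℕ) :
    ‖T k - iteratedFDeriv ℝ p f (x k)‖ ≤
      κC ^ m * (κA + 2 * (m : ℝ) * L) * window s (2 * m) k := by
  refine (h.error_le_window hm hκA hκC hL hf hlip hx k).trans ?_
  have hlt : k % m ≤ m := (Nat.mod_lt k hm).le
  have h1 : κC ^ (k % m) ≤ κC ^ m := pow_le_pow_right₀ hκC hlt
  have h2 : ((k % m : ℕ) : ℝ) ≤ m := by exact_mod_cast hlt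
  have h3 : window s (m + k % m) k ≤ window s (2 * m) k := window_mono s (by omega) k
  have hw := window_nonneg s (m + k % m) k
  have hκC0 : 0 ≤ κC := by linarith
  gcongr

/-! ### One step of the algorithm -/

theorem approxTaylor_zero {p : ℕ} (hp : 0 < p) (f : Vec n → ℝ) (x : Vec n) (T : Tensor n p) :
    approxTaylor p f x T 0 = f x := by
  have hT : T (fun _ => 0) = 0 := T.map_coord_zero ⟨0, hp⟩ rfl
  have hsum : ∑ i ∈ Finset.Icc 1 (p - 1),
      (1 / (i.factorial : ℝ)) * iteratedFDeriv ℝ i f x (fun _ => (0 : Vec n)) = 0 := by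
    refine Finset.sum_eq_zero fun i hi => ?_
    rw [(iteratedFDeriv ℝ i f x).map_coord_zero ⟨0, (Finset.mem_Icc.mp hi).1⟩ rfl, mul_zero]
  rw [approxTaylor, hsum, hT]
  ring

theorem model_zero {p : ℕ} (hp : 0 < p) (f : Vec n → ℝ) (x : Vec n) (T : Tensor n p) (σ : ℝ) :
    model p f x T σ 0 = f x := by
  simp [model, approxTaylor_zero hp]

/-- Model decrease puts the approximate Taylor value below `f x` by the regularization term; the
order-zero remainder passes from that value to `f (x + s)`. -/
theorem map_add_le_of_model_le {p : ℕ} (hp : 0 < p) {f : Vec n → ℝ} (hf : ContDiff ℝ p f) {L : ℝ}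
    (hL : 0 ≤ L)
    (hlip : ∀ x y, ‖iteratedFDeriv ℝ p f x - iteratedFDeriv ℝ p f y‖ ≤ L * ‖x - y‖)
    (x s : Vec n) (T : Tensor n p) {σ : ℝ} (hmodel : model p f x T σ s - model p f x T σ 0 ≤ 0) :
    f (x + s) ≤ f x - σ / ((p + 1).factorial : ℝ) * ‖s‖ ^ (p + 1) +
      (L * ‖s‖ + ‖T - iteratedFDeriv ℝ p f x‖) * ‖s‖ ^ p := by
  rw [model_zero hp, model] at hmodel
  have h := norm_iteratedFDeriv_sub_iteratedFDeriv_approxTaylor_le hp hf hL hlip x s T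
    (Nat.zero_le p)
  have h1 := (iteratedFDeriv ℝ 0 f (x + s) -
    iteratedFDeriv ℝ 0 (approxTaylor p f x T) s).le_opNorm ![]
  simp only [sub_apply, iteratedFDeriv_zero_apply, Finset.univ_eq_empty, Finset.prod_empty,
    mul_one] at h1
  have h2 := (le_abs_self _).trans (h1.trans h)
  rw [Nat.sub_zero] at h2
  linarith

theorem norm_gradient_add_le {p : ℕ} (hp : 0 < p) {f : Vec n → ℝ} (hf : ContDiff ℝ p f) {L : ℝ}
    (hL : 0 ≤ L)
    (hlip : ∀ x y, ‖iteratedFDeriv ℝ p f x - iteratedFDeriv ℝ p f y‖ ≤ L * ‖x - y‖)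
    (x s : Vec n) (T : Tensor n p) :
    ‖∇ f (x + s)‖ ≤ ‖∇ (approxTaylor p f x T) s‖ +
      (L * ‖s‖ + ‖T - iteratedFDeriv ℝ p f x‖) * ‖s‖ ^ (p - 1) := by
  have h := norm_iteratedFDeriv_sub_iteratedFDeriv_approxTaylor_le hp hf hL hlip x s T
    (i := 1) hp
  have h1 := norm_gradient_sub_le f (approxTaylor p f x T) (x + s) s
  have h2 := norm_le_norm_add_norm_sub' (∇ f (x + s)) (∇ (approxTaylor p f x T) s)
  linarith

theorem negCurv_add_le {p : ℕ} (hp : 2 ≤ p) {f : Vec n → ℝ} (hf : ContDiff ℝ p f) {L : ℝ}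
    (hL : 0 ≤ L)
    (hlip : ∀ x y, ‖iteratedFDeriv ℝ p f x - iteratedFDeriv ℝ p f y‖ ≤ L * ‖x - y‖)
    (x s : Vec n) (T : Tensor n p) :
    negCurv f (x + s) ≤ negCurv (approxTaylor p f x T) s +
      (L * ‖s‖ + ‖T - iteratedFDeriv ℝ p f x‖) * ‖s‖ ^ (p - 2) := by
  have h := norm_iteratedFDeriv_sub_iteratedFDeriv_approxTaylor_le (by omega) hf hL hlip x s T
    (i := 2) hp
  have h0 := negCurv_nonneg (approxTaylor p f x T) s
  refine negCurv_le (hf.of_le (by exact_mod_cast hp)) (by positivity) fun v => ?_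
  have h1 := (iteratedFDeriv ℝ 2 f (x + s) -
    iteratedFDeriv ℝ 2 (approxTaylor p f x T) s).le_opNorm (fun _ => v)
  simp only [sub_apply, Finset.prod_const, Finset.card_univ, Fintype.card_fin] at h1
  have h2 := neg_le_of_abs_le (h1.trans (mul_le_mul_of_nonneg_right h (by positivity)))
  have h3 := neg_negCurv_mul_le
    (contDiff_approxTaylor (k := 2) (by omega : 0 < p) f x T) s v
  rw [add_mul]
  linarith

theorem neg_iteratedFDeriv_one_le (f : Vec n → ℝ) (x s : Vec n) :
    -iteratedFDeriv ℝ 1 f x (fun _ => s) ≤ ‖∇ f x‖ * ‖s‖ := by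
  rw [iteratedFDeriv_one_apply, gradient, LinearIsometryEquiv.norm_map]
  exact (neg_le_abs _).trans ((fderiv ℝ f x).le_opNorm s)

/-- A step of length at least one that decreases the model is bounded in terms of the derivatives
of the objective function and of the tensor error. -/
theorem sigma_mul_norm_le {p : ℕ} (hp : 2 ≤ p) {L κhigh κp flow σ : ℝ} {f : Vec n → ℝ}
    (hf : ObjectiveAssumptions p L κhigh κp flow f) (hκhigh : 0 ≤ κhigh) (x s : Vec n)
    (T : Tensor n p) (hmodel : model p f x T σ s - model p f x T σ 0 ≤ 0) (hs : 1 ≤ ‖s‖) :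
    σ * ‖s‖ ≤ (p + 1).factorial * (p * (‖∇ f x‖ + negCurv f x + κhigh + |κp| +
      ‖T - iteratedFDeriv ℝ p f x‖)) := by
  set r := ‖s‖ with hr
  have hr0 : 0 < r := by linarith
  set g := ‖∇ f x‖ with hg
  have hg0 : 0 ≤ g := norm_nonneg _
  set b := negCurv f x with hb
  have hb0 : 0 ≤ b := negCurv_nonneg f x
  set e := ‖T - iteratedFDeriv ℝ p f x‖ with he
  have he0 : 0 ≤ e := norm_nonneg _
  have hκp := abs_nonneg κp
  have h2d : ContDiff ℝ 2 f := hf.contDiff.of_le (by exact_mod_cast hp)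
  have hcurv := neg_negCurv_mul_le h2d x s
  set c := g + b + κhigh + |κp| + e with hc
  have hc0 : 0 ≤ c := by positivity
  have hlow : ∀ i ∈ Finset.Icc 1 (p - 1),
      -((1 / (i.factorial : ℝ)) * iteratedFDeriv ℝ i f x (fun _ => s)) ≤ c * r ^ p := by
    intro i hi
    obtain ⟨hi1, hi2⟩ := Finset.mem_Icc.mp hi
    have hpow : r ^ i ≤ r ^ p := pow_le_pow_right₀ hs (by omega)
    have hmain : -iteratedFDeriv ℝ i f x (fun _ => s) ≤ c * r ^ i := by
      rcases Nat.lt_or_ge i 3 with h3 | h3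
      · interval_cases i
        · refine (neg_iteratedFDeriv_one_le f x s).trans ?_
          rw [pow_one]
          exact mul_le_mul_of_nonneg_right (by linarith) hr0.le
        · have : b * r ^ 2 ≤ c * r ^ 2 := mul_le_mul_of_nonneg_right (by linarith) (by positivity)
          linarith
      -- The one-sided bound is stated on the unit ball; homogeneity of degree `i` transfers it to
      -- `s`.
      · have hint := hf.intermediate i (Finset.mem_Icc.mpr ⟨h3, hi2⟩) x (r⁻¹ • s)
          (by rw [norm_smul, norm_inv, norm_norm, inv_mul_cancel₀ hr0.ne'])
        have hhom : iteratedFDeriv ℝ i f x (fun _ => s) =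
            r ^ i * iteratedFDeriv ℝ i f x (fun _ => r⁻¹ • s) := by
          have := (iteratedFDeriv ℝ i f x).map_smul_univ (fun _ => r) (fun _ => r⁻¹ • s)
          simp only [smul_smul, mul_inv_cancel₀ hr0.ne', one_smul, Finset.prod_const,
            Finset.card_univ, Fintype.card_fin, smul_eq_mul] at this
          exact this
        have h4 : r ^ i * (-κhigh) ≤ r ^ i * iteratedFDeriv ℝ i f x (fun _ => r⁻¹ • s) :=
          mul_le_mul_of_nonneg_left hint (by positivity)
        have h5 : κhigh * r ^ i ≤ c * r ^ i :=
          mul_le_mul_of_nonneg_right (by linarith) (by positivity)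
        rw [hhom]
        linarith
    have hfac : (1 : ℝ) ≤ i.factorial := by exact_mod_cast i.factorial_pos
    have hfac' : 1 / (i.factorial : ℝ) ≤ 1 := by rw [div_le_one (by linarith)]; exact hfac
    calc _ = (1 / (i.factorial : ℝ)) * -iteratedFDeriv ℝ i f x (fun _ => s) := by ring
      _ ≤ (1 / (i.factorial : ℝ)) * (c * r ^ i) := by gcongr
      _ ≤ 1 * (c * r ^ i) := by gcongr
      _ ≤ c * r ^ p := by rw [one_mul]; gcongr
  have htop : -((1 / (p.factorial : ℝ)) * T (fun _ => s)) ≤ c * r ^ p := by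
    have h1 := (T - iteratedFDeriv ℝ p f x).le_opNorm (fun _ => s)
    simp only [sub_apply, Finset.prod_const, Finset.card_univ, Fintype.card_fin] at h1
    have h2 := neg_le_of_abs_le h1
    have h3 : -iteratedFDeriv ℝ p f x (fun _ => s) ≤ (b + |κp|) * r ^ p := by
      -- For `p = 2` the top derivative is the Hessian, bounded below by the negative curvature;
      -- `κp` is available only for `p ≥ 3`.
      rcases Nat.lt_or_ge p 3 with h3 | h3
      · obtain rfl : p = 2 := by omega
        have : 0 ≤ |κp| * r ^ 2 := by positivity
        linarith
      · have h4 := (iteratedFDeriv ℝ p f x).le_opNorm (fun _ => s)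
        simp only [Finset.prod_const, Finset.card_univ, Fintype.card_fin] at h4
        have h5 := neg_le_of_abs_le h4
        have h6 := mul_le_mul_of_nonneg_right ((hf.bounded h3 x).trans (le_abs_self κp))
          (by positivity : 0 ≤ r ^ p)
        have : 0 ≤ b * r ^ p := by positivity
        linarith
    have hmain : -T (fun _ => s) ≤ c * r ^ p := by
      have : 0 ≤ (g + κhigh) * r ^ p := by positivity
      rw [hc]
      linarith
    have hfac : (1 : ℝ) ≤ p.factorial := by exact_mod_cast p.factorial_pos
    have hfac' : 1 / (p.factorial : ℝ) ≤ 1 := by rw [div_le_one (by linarith)]; exact hfac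
    calc _ = (1 / (p.factorial : ℝ)) * -T (fun _ => s) := by ring
      _ ≤ (1 / (p.factorial : ℝ)) * (c * r ^ p) := by gcongr
      _ ≤ 1 * (c * r ^ p) := by gcongr
      _ = c * r ^ p := one_mul _
  have hsum := Finset.sum_le_sum hlow
  rw [Finset.sum_neg_distrib, Finset.sum_const, Nat.card_Icc, nsmul_eq_mul,
    Nat.add_sub_cancel, Nat.cast_sub (by omega : 1 ≤ p), Nat.cast_one] at hsum
  rw [model_zero (by omega), model, approxTaylor] at hmodel
  -- There are `p` terms in all: `p - 1` from the sum and the tensor term.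
  have htot : σ / ((p + 1).factorial : ℝ) * r ^ (p + 1) ≤ p * (c * r ^ p) := by linarith
  have hfac : (0 : ℝ) < (p + 1).factorial := by positivity
  have hrp : 0 < r ^ p := by positivity
  refine le_of_mul_le_mul_right ?_ hrp
  calc σ * r * r ^ p = (p + 1).factorial * (σ / ((p + 1).factorial : ℝ) * r ^ (p + 1)) := by
        field_simp
        ring
    _ ≤ (p + 1).factorial * (p * (c * r ^ p)) := by gcongr
    _ = _ := by ring

/-! ### From a run of the algorithm to the scalar recurrences -/

theorem IsRun.sigma_nonneg {n p m : ℕ} {σ₀ θ₁ θ₂ κA κB κC : ℝ} (hσ₀ : 0 < σ₀)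
    {f : Vec n → ℝ} {x s : ℕ → Vec n} {σ : ℕ → ℝ} {T : ℕ → Tensor n p}
    (h : IsRun p m σ₀ θ₁ θ₂ κA κB κC f x s σ T) (k : ℕ) : 0 ≤ σ k := by
  induction k with
  | zero => rw [h.sigma_zero]; exact hσ₀.le
  | succ k ih => rw [h.sigma_succ]; positivity

/-- Both the step length and the window are at most `r + V`, so every remainder becomes a power of
`r + V`. `K` is the sum of the constants needed by the separate inequalities. -/
theorem IsRun.stepRecurrence {n p m : ℕ} (hp : 2 ≤ p) (hm : 1 ≤ m)
    {σ₀ θ₁ θ₂ κA κB κC L κhigh κp flow G E K : ℝ} (hσ₀ : 0 < σ₀) (hθ₁ : 1 < θ₁) (hθ₂ : 1 < θ₂)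
    (hκA : 0 ≤ κA) (hκC : 1 ≤ κC) (hL : 0 ≤ L) (hκhigh : 0 ≤ κhigh)
    (hE : E = κC ^ m * (κA + 2 * (m : ℝ) * L))
    (hK : K = θ₁ + θ₂ + (L + E) + (p + 1).factorial * (p * (1 + κhigh + |κp| + E)))
    {f : Vec n → ℝ} {x s : ℕ → Vec n} {σ : ℕ → ℝ} {T : ℕ → Tensor n p}
    (hf : ObjectiveAssumptions p L κhigh κp flow f)
    (h : IsRun p m σ₀ θ₁ θ₂ κA κB κC f x s σ T)
    (hφ : f (x 0) - flow ≤ G) (hg : ‖∇ f (x 0)‖ ≤ G) (hb : negCurv f (x 0) ≤ G) :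
    StepRecurrence p K ((((2 * m : ℕ) : ℝ) + 1) ^ (p + 2)) G σ₀ (fun k => f (x k) - flow)
      (fun k => ‖∇ f (x k)‖) (fun k => negCurv f (x k)) σ (fun k => ‖s k‖)
      (fun k => window s (2 * m) k) := by
  have hκC0 : 0 ≤ κC := by linarith
  have hE0 : 0 ≤ E := by rw [hE]; positivity
  have hκp := abs_nonneg κp
  have hP0 : 0 ≤ (p + 1).factorial * (p * (1 + κhigh + |κp| + E)) := by positivity
  have hp0 : 0 < p := by omega
  have herr : ∀ k, ‖T k - iteratedFDeriv ℝ p f (x k)‖ ≤ E * window s (2 * m) k := fun k => by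
    rw [hE]; exact h.tensor.error_le hm hκA hκC hL hf.contDiff hf.lipschitz h.iterate k
  have hσ := h.sigma_nonneg hσ₀
  have hV : ∀ k : ℕ, 0 ≤ window s (2 * m) k := fun k => window_nonneg s _ _
  have hrem : ∀ k : ℕ, L * ‖s k‖ + ‖T k - iteratedFDeriv ℝ p f (x k)‖ ≤
      (L + E) * (‖s k‖ + window s (2 * m) k) := fun k => by
    have h1 : 0 ≤ E * ‖s k‖ := by positivity
    have h2 := mul_nonneg hL (hV k)
    linarith [herr k]
  have hrW : ∀ k : ℕ, ‖s k‖ ≤ ‖s k‖ + window s (2 * m) k := fun k => by linarith [hV k]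
  have hW : ∀ k : ℕ, 0 ≤ ‖s k‖ + window s (2 * m) k := fun k => (norm_nonneg _).trans (hrW k)
  have hremPow : ∀ k i : ℕ,
      (L * ‖s k‖ + ‖T k - iteratedFDeriv ℝ p f (x k)‖) * ‖s k‖ ^ i ≤
        (L + E) * (‖s k‖ + window s (2 * m) k) ^ (i + 1) := fun k i => by
    have hW' := hW k
    calc _ ≤ ((L + E) * (‖s k‖ + window s (2 * m) k)) * (‖s k‖ + window s (2 * m) k) ^ i :=
          mul_le_mul (hrem k) (pow_le_pow_left₀ (norm_nonneg _) (hrW k) i) (by positivity)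
            (by positivity)
      _ = _ := by ring
  have hregPow : ∀ (θ : ℝ) (k i : ℕ), 0 ≤ θ → θ * σ k * ‖s k‖ ^ i / (i.factorial : ℝ) ≤
      θ * σ k * (‖s k‖ + window s (2 * m) k) ^ i := fun θ k i hθ => by
    have hσk := hσ k
    have hfac : (1 : ℝ) ≤ i.factorial := by exact_mod_cast i.factorial_pos
    exact (div_le_self (by positivity) hfac).trans (mul_le_mul_of_nonneg_left
      (pow_le_pow_left₀ (norm_nonneg _) (hrW k) i) (by positivity))
  have hcomb : ∀ (θ : ℝ) (k i : ℕ), 0 ≤ θ → θ ≤ K → L + E ≤ K →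
      θ * σ k * (‖s k‖ + window s (2 * m) k) ^ i +
        (L + E) * (‖s k‖ + window s (2 * m) k) ^ i ≤
      K * (1 + σ k) * (‖s k‖ + window s (2 * m) k) ^ i := fun θ k i hθ h1 h2 => by
    have hσk := hσ k
    rw [← add_mul]
    refine mul_le_mul_of_nonneg_right ?_ (pow_nonneg (hW k) i)
    have := mul_le_mul_of_nonneg_right h1 hσk
    linarith
  have hθ₁K : θ₁ ≤ K := by linarith
  have hθ₂K : θ₂ ≤ K := by linarith
  have hLEK : L + E ≤ K := by linarith
  refine ⟨fun k => by linarith [hf.lower_bound (x k)], fun k => norm_nonneg _, hV, hφ, hg, hb,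
    h.sigma_zero, h.sigma_succ, fun k => ?_, fun k => sum_window_pow_le s _ k p, fun k => ?_,
    fun k => ?_, fun k => ?_, fun k hk => ?_⟩
  · refine (window_pow_le s (2 * m) k p).trans ?_
    refine mul_le_mul_of_nonneg_right ?_ (by positivity)
    have hN : (0 : ℝ) ≤ ((2 * m : ℕ) : ℝ) := by positivity
    exact (pow_le_pow_left₀ hN (by linarith) _).trans
      (pow_le_pow_right₀ (by linarith) (by omega))
  · have h1 := map_add_le_of_model_le hp0 hf.contDiff hL hf.lipschitz (x k) (s k) (T k)
      (h.model_decrease k)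
    have h2 := hremPow k p
    have h3 := mul_le_mul_of_nonneg_right hLEK (pow_nonneg (hW k) (p + 1))
    simp only [h.iterate k]
    linarith
  · have h1 := norm_gradient_add_le hp0 hf.contDiff hL hf.lipschitz (x k) (s k) (T k)
    have h2 := hremPow k (p - 1)
    rw [Nat.sub_add_cancel hp0] at h2
    have h3 := (h.first_order k).trans (hregPow θ₁ k p (by linarith))
    have h4 := hcomb θ₁ k p (by linarith) hθ₁K hLEK
    simp only [h.iterate k]
    linarith
  · have h1 := negCurv_add_le hp hf.contDiff hL hf.lipschitz (x k) (s k) (T k)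
    have h2 := hremPow k (p - 2)
    rw [show p - 2 + 1 = p - 1 by omega] at h2
    have h3 := (h.second_order k).trans (hregPow θ₂ k (p - 1) (by linarith))
    have h4 := hcomb θ₂ k (p - 1) (by linarith) hθ₂K hLEK
    simp only [h.iterate k]
    linarith
  · have h1 := sigma_mul_norm_le hp hf hκhigh (x k) (s k) (T k) (h.model_decrease k) hk
    refine h1.trans ?_
    set g := ‖∇ f (x k)‖
    set b := negCurv f (x k)
    have hg0 : 0 ≤ g := norm_nonneg _
    have hb0 : 0 ≤ b := negCurv_nonneg f (x k)
    have hVk := hV k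
    set w := window s (2 * m) k
    have h2 : g + b + κhigh + |κp| + ‖T k - iteratedFDeriv ℝ p f (x k)‖ ≤
        (1 + κhigh + |κp| + E) * (1 + g + b + w) := by
      have h3 := herr k
      have h4 : 0 ≤ (κhigh + |κp| + E) * (g + b) + (1 + κhigh + |κp|) * w + (1 + E) := by
        positivity
      linarith
    calc _ ≤ ((p + 1).factorial : ℝ) * (p * ((1 + κhigh + |κp| + E) * (1 + g + b + w))) := by
          gcongr
      _ = (p + 1).factorial * (p * (1 + κhigh + |κp| + E)) * (1 + g + b + w) := by ring
      _ ≤ K * (1 + g + b + w) := by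
          refine mul_le_mul_of_nonneg_right ?_ (by positivity)
          linarith

end ARpApprox

end

/-! ### Choice of the constants and the main theorem. -/

theorem mainTheorem1 (p m : ℕ) (hp : 2 ≤ p) (hm : 1 ≤ m)
    (σ₀ θ₁ θ₂ κA κB κC L κhigh κp Δ₀ G₀ B₀ : ℝ)
    (hσ₀ : 0 < σ₀) (hθ₁ : 1 < θ₁) (hθ₂ : 1 < θ₂) (hκA : 0 ≤ κA) (hκB : 0 ≤ κB) (hκC : 1 ≤ κC)
    (hL : 3 ≤ L) (hκhigh : 0 ≤ κhigh) :
    ∃ C : ℝ, 0 < C ∧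
      ∀ (n : ℕ) (f : ARpApprox.Vec n → ℝ) (flow : ℝ)
        (x s : ℕ → ARpApprox.Vec n) (σ : ℕ → ℝ) (T : ℕ → ARpApprox.Tensor n p),
        ARpApprox.ObjectiveAssumptions p L κhigh κp flow f →
        ARpApprox.IsRun p m σ₀ θ₁ θ₂ κA κB κC f x s σ T →
        f (x 0) - flow ≤ Δ₀ → ‖gradient f (x 0)‖ ≤ G₀ → ARpApprox.negCurv f (x 0) ≤ B₀ →
        (∀ k : ℕ,
          (Finset.Icc 1 (k + 1)).inf' (Finset.nonempty_Icc.mpr (Nat.le_add_left 1 k))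
              (fun j => ‖gradient f (x j)‖) ≤
            C * ((k : ℝ) + 1) ^ (-((p : ℝ) / ((p : ℝ) + 1)))) ∧
        (∀ k : ℕ,
          (Finset.Icc 1 (k + 1)).inf' (Finset.nonempty_Icc.mpr (Nat.le_add_left 1 k))
              (fun j => ARpApprox.negCurv f (x j)) ≤
            C * ((k : ℝ) + 1) ^ (-(((p : ℝ) - 1) / ((p : ℝ) + 1)))) ∧
        (∀ ε₁ ε₂ : ℝ, 0 < ε₁ → 0 < ε₂ →
          ∃ j : ℕ,
            (j : ℝ) ≤ C * max (ε₁ ^ (-(((p : ℝ) + 1) / (p : ℝ))))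
                (ε₂ ^ (-(((p : ℝ) + 1) / ((p : ℝ) - 1)))) ∧
            ARpApprox.IsSecondOrderStationary f ε₁ ε₂ (x j)) := by
  set E : ℝ := κC ^ m * (κA + 2 * (m : ℝ) * L) with hE
  set K : ℝ := θ₁ + θ₂ + (L + E) + (p + 1).factorial * (p * (1 + κhigh + |κp| + E)) with hK
  set G : ℝ := |Δ₀| + |G₀| + |B₀| with hG
  have hκC0 : 0 ≤ κC := by linarith
  have hL0 : 0 ≤ L := by linarith
  have hE0 : 0 ≤ E := by positivity
  have hK0 : 0 ≤ K := by
    have := abs_nonneg κp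
    have : 0 ≤ (p + 1).factorial * (p * (1 + κhigh + |κp| + E)) := by positivity
    linarith
  obtain ⟨C₀, hC₀0, hC₀⟩ := ARpApprox.StepRecurrence.exists_rate (p := p) (by omega) hK0
    (M := (((2 * m : ℕ) : ℝ) + 1) ^ (p + 2)) (by positivity) (G := G) (by positivity) hσ₀
  -- `C₀` serves the rates, `G` covers the initial values when index 0 is the answer, and 1 ensures
  -- positivity.
  set C₁ : ℝ := C₀ + G + 1 with hC₁
  have hG0 : 0 ≤ G := by positivity
  have hC₁0 : 0 < C₁ := by linarith
  have hp2 : (2 : ℝ) ≤ p := by exact_mod_cast hp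
  have ha₁ : 0 < (p : ℝ) / ((p : ℝ) + 1) := by positivity
  have ha₂ : 0 < ((p : ℝ) - 1) / ((p : ℝ) + 1) := div_pos (by linarith) (by positivity)
  have hR1 : 0 < C₁ ^ ((p : ℝ) / ((p : ℝ) + 1))⁻¹ := Real.rpow_pos_of_pos hC₁0 _
  have hR2 : 0 < C₁ ^ (((p : ℝ) - 1) / ((p : ℝ) + 1))⁻¹ := Real.rpow_pos_of_pos hC₁0 _
  refine ⟨C₁ + 2 * (C₁ ^ ((p : ℝ) / ((p : ℝ) + 1))⁻¹ +
    C₁ ^ (((p : ℝ) - 1) / ((p : ℝ) + 1))⁻¹), by positivity, ?_⟩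
  intro n f flow x s σ T hf h hφ hg hb
  have hΔ := le_abs_self Δ₀
  have hG' := le_abs_self G₀
  have hB := le_abs_self B₀
  have hΔ0 := abs_nonneg Δ₀
  have hG'0 := abs_nonneg G₀
  have hB0 := abs_nonneg B₀
  have hrec := h.stepRecurrence hp hm hσ₀ hθ₁ hθ₂ hκA hκC hL0 hκhigh hE hK hf
    (G := G) (by linarith) (by linarith) (by linarith)
  have hrate : ∀ k : ℕ, ∃ j ≤ k,
      ‖gradient f (x (j + 1))‖ ≤ C₁ * ((k : ℝ) + 1) ^ (-((p : ℝ) / ((p : ℝ) + 1))) ∧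
      ARpApprox.negCurv f (x (j + 1)) ≤
        C₁ * ((k : ℝ) + 1) ^ (-(((p : ℝ) - 1) / ((p : ℝ) + 1))) := by
    intro k
    obtain ⟨j, hj, h1, h2⟩ := hC₀ _ _ _ _ _ _ hrec k
    have hk : (0 : ℝ) ≤ (k : ℝ) + 1 := by positivity
    have hle : C₀ ≤ C₁ := by linarith
    exact ⟨j, hj, h1.trans (mul_le_mul_of_nonneg_right hle (Real.rpow_nonneg hk _)),
      h2.trans (mul_le_mul_of_nonneg_right hle (Real.rpow_nonneg hk _))⟩
  refine ⟨fun k => ?_, fun k => ?_, fun ε₁ ε₂ hε₁ hε₂ => ?_⟩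
  · obtain ⟨j, hj, h1, -⟩ := hrate k
    refine (Finset.inf'_le _ (Finset.mem_Icc.mpr ⟨Nat.le_add_left 1 j, by omega⟩)).trans
      (h1.trans ?_)
    exact mul_le_mul_of_nonneg_right (by linarith) (Real.rpow_nonneg (by positivity) _)
  · obtain ⟨j, hj, -, h1⟩ := hrate k
    refine (Finset.inf'_le _ (Finset.mem_Icc.mpr ⟨Nat.le_add_left 1 j, by omega⟩)).trans
      (h1.trans ?_)
    exact mul_le_mul_of_nonneg_right (by linarith) (Real.rpow_nonneg (by positivity) _)
  · obtain ⟨j, hj, h1, h2⟩ := ARpApprox.exists_index_of_rates ha₁ ha₂ hC₁0 hε₁ hε₂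
      (g := fun k => ‖gradient f (x k)‖) (b := fun k => ARpApprox.negCurv f (x k))
      (by linarith) (by linarith) hrate
    refine ⟨j, hj.trans ?_, h1, ?_⟩
    · rw [inv_div, inv_div]
      refine mul_le_mul_of_nonneg_right (by linarith) ?_
      exact (Real.rpow_nonneg hε₁.le _).trans (le_max_left _ _)
    · have h3 : -ARpApprox.lambdaMin (ARpApprox.hessian f (x j)) ≤ ε₂ :=
        (le_max_right _ _).trans h2
      linarith
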